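/- **Theorem 7.1.** Let $q$ be a prime power, let $n\ge 1$, let $\Sigma_{n-1}=\mathrm{PG}(n-1,q)$ be the $(n-1)$-dimensional projective space over $\mathbb F_q$, and let $G$ be a Singer cycle of $\Sigma_{n-1}$, that is, the subgroup of $\mathrm{PGL}(n,q)$ induced by a cyclic subgroup of order $q^n-1$ of $\mathrm{GL}(n,q)$. Let $\mathcal G_q(n-1,d-1)$ denote the set of $(d-1)$-dimensional projective subspaces of $\Sigma_{n-1}$ (the empty subspace being the only one of dimension $-1$). Let $\Sigma_{k-1}\in\mathcal G_q(n-1,k-1)$, $0\le k\le n$, $(n,k)\neq(1,0)$, and let $$\mathcal I_{\mathrm{Orb}_G(\Sigma_{k-1})}=\{\Sigma_{k-1}\cap\varphi(\Sigma_{k-1}) : \varphi\in G\}.$$ Fix an $\mathbb F_q$-basis of $\mathbb F_{q^n}$ and use it to identify $\mathbb F_q^n$ with $\mathbb F_{q^n}$; let $G_0\le\mathrm{PGL}(n,q)$ be the group induced by the multiplications $x\mapsto ax$, $a\in\mathbb F_{q^n}^*$, and for an $\mathbb F_q$-subspace $S$ of $\mathbb F_{q^n}$ let $\mathrm{PG}(S)$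 be the projective subspace of $\Sigma_{n-1}$ that it defines. Then $$\mathcal I_{\mathrm{Orb}_G(\Sigma_{k-1})}\cap\mathcal G_q(n-1,d-1)\neq\emptyset\quad\text{for every } d\in\{0,\dots,k-1\}$$ if and only if the pair $(G,\Sigma_{k-1})$ is equivalent under $\mathrm{PGL}(n,q)$ to a pair $(G_0,\mathrm{PG}(S))$, that is, there is $g\in\mathrm{PGL}(n,q)$ with $gGg^{-1}=G_0$ and $g(\Sigma_{k-1})=\mathrm{PG}(S)$, where $S$ is one of the following: 1. $S=\langle 1,\lambda,\dots,\lambda^{k-1}\rangle_{\mathbb F_q}$ for some $\lambda\in\mathbb F_{q^n}\setminus\mathbb F_q$, where $k\le\frac{[\mathbb F_q(\lambda):\mathbb F_q]+1}{2}$ if $[\mathbb F_q(\lambda):\mathbb F_q]<n$, and $k\le\frac n2$ if $[\mathbb F_q(\lambda):\mathbb F_q]=n$; 2. $S=\langle 1,\lambda,\dots,\lambda^{l-1}\rangle_{\mathbb F_{q^2}}\oplus\lambda^l\mathbb F_q$ for some $\lambda\in\mathbb F_{q^n}\setminus\mathbb F_{q^2}$, where $n$ is even, $k=2l+1$ and $l<\frac{[\mathbb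 F_{q^2}(\lambda):\mathbb F_{q^2}]}{2}$. -/

import Mathlib

open scoped LinearAlgebra.Projectivization

namespace SingerOrbit

variable {K : Type*} [Field K] {n : ℕ}

/-- The projective dimension of a subspace of a projective space: one less than the vector space
dimension of the underlying linear subspace. The empty subspace has dimension `-1`. -/
noncomputable def projDim (Λ : Projectivization.Subspace K (Fin n → K)) : ℤ :=
  (Module.finrank K Λ.submodule : ℤ) - 1

/-- The image `g(Λ)` of a projective subspace `Λ` under `g ∈ PGL(n, K)`; its points are the
points `g • p` with `p ∈ Λ`, see `coe_image`. -/
def image (g : Matrix.ProjGenLinGroup (Fin n) K)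
    (Λ : Projectivization.Subspace K (Fin n → K)) : Projectivization.Subspace K (Fin n → K) where
  carrier := {p | g⁻¹ • p ∈ Λ}
  mem_add' := by
    intro v w hv hw hvw h₁ h₂
    generalize g⁻¹ = g' at h₁ h₂ ⊢
    induction g' using Matrix.ProjGenLinGroup.induction_on with
    | mk h =>
      simp only [Set.mem_ofPred_eq, Projectivization.PGL.mk_smul_mk, smul_add] at h₁ h₂ ⊢
      exact Λ.mem_add _ _ _ _ _ h₁ h₂

theorem coe_image (g : Matrix.ProjGenLinGroup (Fin n) K)
    (Λ : Projectivization.Subspace K (Fin n → K)) :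
    (image g Λ : Set (ℙ K (Fin n → K))) = (fun p => g • p) '' (Λ : Set (ℙ K (Fin n → K))) := by
  ext p
  constructor
  · intro hp
    exact ⟨g⁻¹ • p, hp, smul_inv_smul g p⟩
  · rintro ⟨r, hr, rfl⟩
    change g⁻¹ • g • r ∈ Λ
    rwa [inv_smul_smul]

/-- A Singer subgroup of `GL(n, q)`: a cyclic subgroup of order `q ^ n - 1`. -/
def IsSingerSubgroup (H : Subgroup (Matrix.GeneralLinearGroup (Fin n) K)) : Prop :=
  IsCyclic H ∧ Nat.card H = Nat.card K ^ n - 1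

/-- A Singer cycle of `PG(n - 1, q)`: the group of projectivities induced by a Singer subgroup of
`GL(n, q)`. -/
def IsSingerCycle (G : Subgroup (Matrix.ProjGenLinGroup (Fin n) K)) : Prop :=
  ∃ H : Subgroup (Matrix.GeneralLinearGroup (Fin n) K),
    IsSingerSubgroup H ∧ G = H.map Matrix.ProjGenLinGroup.mk

/-- The set of all intersections `Λ ∩ φ(Λ)`, for `φ ∈ G`. -/
def orbitIntersections (G : Subgroup (Matrix.ProjGenLinGroup (Fin n) K))
    (Λ : Projectivization.Subspace K (Fin n → K)) :
    Set (Projectivization.Subspace K (Fin n → K)) :=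
  {Γ | ∃ φ ∈ G, Γ = Λ ⊓ image φ Λ}

/-- The set of all subspaces of projective dimension `d`. -/
def projGrassmannian (K : Type*) [Field K] (n : ℕ) (d : ℤ) :
    Set (Projectivization.Subspace K (Fin n → K)) :=
  {Γ | projDim Γ = d}

section Field

variable {L : Type*} [Field L] [Algebra K L]

/-- The group of projectivities of `PG(n - 1, q)` induced by the multiplications `x ↦ a x` with
`a ∈ L ∖ {0}`, where `L` is the extension field of degree `n`, identified with `K ^ n` by means of
the basis `B`. -/
noncomputable def fieldSingerCycle (B : Module.Basis (Fin n) K L) :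
    Subgroup (Matrix.ProjGenLinGroup (Fin n) K) :=
  (Matrix.ProjGenLinGroup.mk.comp
    (Units.map ((Algebra.leftMulMatrix B : L →ₐ[K] Matrix (Fin n) (Fin n) K) :
      L →* Matrix (Fin n) (Fin n) K))).range

/-- The projective subspace of `PG(n - 1, q)` defined by a `K`-subspace `S` of `L`, where `L` is
identified with `K ^ n` by means of the basis `B`. -/
noncomputable def definedBy (B : Module.Basis (Fin n) K L) (S : Submodule K L) :
    Projectivization.Subspace K (Fin n → K) :=
  (S.map (B.equivFun : L →ₗ[K] (Fin n → K))).projectivization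

open IntermediateField in
/-- Family (1): `S = ⟨1, x, …, x ^ (k - 1)⟩` over `K = F_q` with `x ∈ L ∖ K`, where `L = F_{q^n}`,
`k ≤ ([K(x) : K] + 1) / 2` if `[K(x) : K] < n`, and `k ≤ n / 2` if `[K(x) : K] = n`. -/
def IsFamilyOne (k : ℕ) (S : Submodule K L) : Prop :=
  ∃ x : L, x ∉ Set.range (algebraMap K L) ∧
    (Module.finrank K K⟮x⟯ < Module.finrank K L → (k : ℚ) ≤ (Module.finrank K K⟮x⟯ + 1) / 2) ∧
    (Module.finrank K K⟮x⟯ = Module.finrank K L → (k : ℚ) ≤ Module.finrank K L / 2) ∧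
    S = Submodule.span K {y | ∃ i < k, y = x ^ i}

open IntermediateField in
/-- Family (2): `S = ⟨1, x, …, x ^ (l - 1)⟩_E ⊕ x ^ l K`, where `K = F_q`, `L = F_{q^n}`, `n` is
even, `E = F_{q^2}` is the subfield of `L` of degree `2` over `K`, `x ∈ L ∖ E`, `k = 2 l + 1` and
`l < [E(x) : E] / 2`. -/
def IsFamilyTwo (k : ℕ) (S : Submodule K L) : Prop :=
  Even (Module.finrank K L) ∧
  ∃ (E : IntermediateField K L) (x : L) (l : ℕ),
    Module.finrank K E = 2 ∧ x ∉ E ∧ k = 2 * l + 1 ∧ (l : ℚ) < Module.finrank E E⟮x⟯ / 2 ∧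
    Disjoint ((Submodule.span E {y : L | ∃ i < l, y = x ^ i}).restrictScalars K)
      (Submodule.span K {x ^ l}) ∧
    S = (Submodule.span E {y : L | ∃ i < l, y = x ^ i}).restrictScalars K ⊔
      Submodule.span K {x ^ l}

end Field

end SingerOrbit

/-!
The statement is about the `K`-subspaces `S` of `L = F_{q^n}` for which every `d < dim S` is the
dimension of some `S ∩ γ S` (`FullSpectrum`). The reduction to `L` is
`exists_linearEquiv_of_isSingerSubgroup`: the algebra spanned by a Singer subgroup is a field with
`q ^ n` elements over which `K ^ n` is one-dimensional.

Let `S` have full spectrum and dimension `k ≥ 2`. Some `α` gives `dim (S ∩ α⁻¹ S) = k - 1`, and then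
`S = W ⊕ ⟨b, α b, …, α ^ (r - 1) b⟩` with `W` stable under `F = K(α)` (`exists_pencil`). If `W = 0`
this is the first family, and the bound on `k` comes from the values `d = 0` and `d = 1`. If
`W ≠ 0`, then `S` lies strictly between the `F`-subspaces `W` and `Z = W ⊕ b F`, and comparing the
values that multipliers inside and outside `F` can give shows that some value is missing unless
`[F : K] = 2` and `dim S = dim W + 1` (`gap`). Write `E = F`. The same count provides `β ∉ E`
for which `W ∩ β⁻¹ W` and `Z ∩ β⁻¹ Z` are `E`-hyperplanes of `W` and `Z`, and `exists_pencil`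
decomposes both spaces over `E`. Their `E(β)`-stable parts coincide and vanish, since otherwise
`gap` would apply to `E(β)` and give `[E(β) : K] = 2`. So `W` and `Z` are spans of consecutive powers
of `β`, after a Moebius change of `β` with a common first vector (`exists_common_powSpan`), and `S`
is in the second family.

Conversely, the elements of the two families are polynomials in `x` of small degree, and equations
between their multiples may be read as identities of polynomials. In the first family the
multipliers `x ^ i` give all values, except possibly `0`, which any element outside `K(x)` gives. In
the second family `x ^ i` gives odd values, and `e x ^ i / r(x)`, with `e ∈ E ∖ K` and `r` a monic
polynomial of degree `i` prime to `X`, gives the even ones.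
-/

open scoped LinearAlgebra.Projectivization

namespace SingerOrbit

/-! ### Intersections with multiples and the gap argument -/

section Slice

variable {K L : Type*} [Field K] [Field L] [Algebra K L]

/-- The subspace `{x ∈ S | γ x ∈ S}`. For `γ ≠ 0` it is `S ∩ γ⁻¹ S`, so its dimensions for varying
`γ` are those of the intersections of `S` with the members of its orbit; writing it with a preimage
makes it meaningful for `γ = 0` as well, where it is all of `S`. -/
def slice (S : Submodule K L) (γ : L) : Submodule K L :=
  S ⊓ S.comap (LinearMap.mulLeft K γ)

theorem mem_slice {S : Submodule K L} {γ x : L} : x ∈ slice S γ ↔ x ∈ S ∧ γ * x ∈ S := Iff.rfl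

theorem slice_le (S : Submodule K L) (γ : L) : slice S γ ≤ S := inf_le_left

theorem slice_mono {S Z : Submodule K L} (h : S ≤ Z) (γ : L) : slice S γ ≤ slice Z γ :=
  fun _ hx => ⟨h hx.1, h hx.2⟩

/-- Every `d < dim S` is the dimension of some intersection `S ∩ γ⁻¹ S`. The multiplier `γ = 0` need
not be excluded: it gives the dimension of `S` itself. -/
def FullSpectrum (S : Submodule K L) : Prop :=
  ∀ d < Module.finrank K S, ∃ γ : L, Module.finrank K (slice S γ) = d

variable [FiniteDimensional K L]

theorem finrank_comap_mulLeft (S : Submodule K L) {γ : L} (hγ : γ ≠ 0) :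
    Module.finrank K (S.comap (LinearMap.mulLeft K γ)) = Module.finrank K S := by
  have hinj : Function.Injective (LinearMap.mulLeft K γ) := fun x y h => mul_left_cancel₀ hγ h
  let e := LinearEquiv.ofInjectiveEndo (LinearMap.mulLeft K γ) hinj
  exact LinearEquiv.finrank_eq (e.submoduleMap (S.comap (LinearMap.mulLeft K γ)) |>.trans
    (LinearEquiv.ofEq _ _ (by
      change Submodule.map (LinearMap.mulLeft K γ) _ = S
      exact Submodule.map_comap_eq_of_surjective e.surjective S)))

/-- The multipliers `x` with `x U ⊆ U` form an intermediate field, the largest one over which `U` is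
a subspace; it is closed under inverses because `U` has finite dimension. -/
def stabilizer (U : Submodule K L) : IntermediateField K L where
  carrier := {x | ∀ u ∈ U, x * u ∈ U}
  mul_mem' {x y} hx hy u hu := by
    rw [mul_assoc]; exact hx _ (hy _ hu)
  add_mem' {x y} hx hy u hu := by
    rw [add_mul]; exact U.add_mem (hx _ hu) (hy _ hu)
  algebraMap_mem' r u hu := by
    rw [← Algebra.smul_def]; exact U.smul_mem r hu
  inv_mem' x hx u hu := by
    rcases eq_or_ne x 0 with rfl | h0
    · simp
    have h1 : U ≤ U.comap (LinearMap.mulLeft K x) := hx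
    have h2 := Submodule.eq_of_le_of_finrank_le h1 (finrank_comap_mulLeft U h0).le
    have : x⁻¹ * u ∈ U.comap (LinearMap.mulLeft K x) := by
      simpa [Submodule.mem_comap, mul_inv_cancel_left₀ h0] using hu
    rwa [← h2] at this

/-- `F ≤ stabilizer U` says that `U` is an `F`-subspace; its `K`-dimension is then a multiple of
`[F : K]`. -/
theorem finrank_dvd_of_le_stabilizer {F : IntermediateField K L} {U : Submodule K L}
    (h : F ≤ stabilizer U) : Module.finrank K F ∣ Module.finrank K U := by
  let V : Submodule F L :=
    { U with smul_mem' := fun c x hx => h c.2 x hx }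
  have hV : Module.finrank K V = Module.finrank K U := rfl
  rw [← hV, ← Module.finrank_mul_finrank K F V]
  exact Dvd.intro _ rfl

theorem le_stabilizer_slice {F : IntermediateField K L} {U : Submodule K L}
    (h : F ≤ stabilizer U) (γ : L) : F ≤ stabilizer (slice U γ) := by
  intro f hf u hu
  refine ⟨h hf u hu.1, ?_⟩
  change γ * (f * u) ∈ U
  rw [mul_left_comm]
  exact h hf _ hu.2

theorem le_stabilizer_comap {F : IntermediateField K L} {U : Submodule K L}
    (h : F ≤ stabilizer U) (γ : L) : F ≤ stabilizer (U.comap (LinearMap.mulLeft K γ)) := by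
  intro f hf u hu
  change γ * (f * u) ∈ U
  rw [mul_left_comm]
  exact h hf _ hu

theorem le_stabilizer_inf {F : IntermediateField K L} {U V : Submodule K L}
    (hU : F ≤ stabilizer U) (hV : F ≤ stabilizer V) : F ≤ stabilizer (U ⊓ V) :=
  fun _ hf u hu => ⟨hU hf u hu.1, hV hf u hu.2⟩

theorem finrank_add_le_of_lt {F : IntermediateField K L} {U V : Submodule K L}
    (hU : F ≤ stabilizer U) (hV : F ≤ stabilizer V) (h : U < V) :
    Module.finrank K U + Module.finrank K F ≤ Module.finrank K V := by
  have h1 := Submodule.finrank_lt_finrank_of_lt h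
  obtain ⟨a, ha⟩ := finrank_dvd_of_le_stabilizer hU
  obtain ⟨b, hb⟩ := finrank_dvd_of_le_stabilizer hV
  rw [ha, hb] at h1 ⊢
  have : a < b := lt_of_mul_lt_mul_left h1 (Nat.zero_le _)
  calc _ = Module.finrank K F * (a + 1) := by ring
    _ ≤ _ := Nat.mul_le_mul_left _ this

theorem finrank_slice_add_le {F : IntermediateField K L} {U : Submodule K L}
    (h : F ≤ stabilizer U) {γ : L} (hγ : γ ∉ stabilizer U) :
    Module.finrank K (slice U γ) + Module.finrank K F ≤ Module.finrank K U := by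
  refine finrank_add_le_of_lt (le_stabilizer_slice h γ) h (lt_of_le_of_ne (slice_le _ _) ?_)
  intro he
  refine hγ fun u hu => ?_
  rw [← he] at hu
  exact hu.2

theorem finrank_add_finrank_le_inf {S X Y : Submodule K L} (hX : X ≤ S) (hY : Y ≤ S) :
    Module.finrank K X + Module.finrank K Y ≤
      Module.finrank K (X ⊓ Y : Submodule K L) + Module.finrank K S := by
  have h1 := Submodule.finrank_sup_add_finrank_inf_eq X Y
  have h2 := Submodule.finrank_mono (sup_le hX hY)
  omega

theorem two_mul_finrank_le_slice {S Z : Submodule K L} (hSZ : S ≤ Z) {γ : L}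
    (hγ : γ ∈ stabilizer Z) :
    2 * Module.finrank K S ≤ Module.finrank K (slice S γ) + Module.finrank K Z := by
  rcases eq_or_ne γ 0 with rfl | h0
  · have : slice S (0 : L) = S := le_antisymm (slice_le _ _) fun x hx => ⟨hx, by simp⟩
    rw [this]
    have := Submodule.finrank_mono hSZ
    omega
  · have h1 : S.comap (LinearMap.mulLeft K γ) ≤ Z := by
      intro x hx
      have := (inv_mem hγ : γ⁻¹ ∈ stabilizer Z) _ (hSZ hx)
      simpa [inv_mul_cancel_left₀ h0] using this
    have := finrank_add_finrank_le_inf hSZ h1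
    rw [finrank_comap_mulLeft S h0] at this
    change _ ≤ Module.finrank K (S ⊓ _ : Submodule K L) + _
    omega

/-- Passing from `W` to a superspace `S` of codimension `a` raises the dimension of the slice by at
most `2 a`: one `a` for `W ⊆ S` and one for `γ⁻¹ W ⊆ γ⁻¹ S`. -/
theorem finrank_slice_le_of_le {S W : Submodule K L} (hWS : W ≤ S) {γ : L} (hγ : γ ≠ 0) :
    Module.finrank K (slice S γ) + 2 * Module.finrank K W ≤
      Module.finrank K (slice W γ) + 2 * Module.finrank K S := by
  have h1 := finrank_add_finrank_le_inf (slice_le S γ) hWS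
  have h2 : slice S γ ⊓ W ≤ S.comap (LinearMap.mulLeft K γ) := fun x hx => hx.1.2
  have h3 : W.comap (LinearMap.mulLeft K γ) ≤ S.comap (LinearMap.mulLeft K γ) :=
    Submodule.comap_mono hWS
  have h4 := finrank_add_finrank_le_inf h2 h3
  rw [finrank_comap_mulLeft _ hγ, finrank_comap_mulLeft _ hγ] at h4
  have h5 : slice S γ ⊓ W ⊓ W.comap (LinearMap.mulLeft K γ) ≤ slice W γ :=
    fun x hx => ⟨hx.1.2, hx.2⟩
  have := Submodule.finrank_mono h5
  omega

/-- If `Z` were stable under a field larger than `F`, the multipliers stabilizing `Z` would give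
intersections of dimension at least `2 dim S - dim Z`, and all others would lose `2 [F : K]` inside
`Z`, so that the value `2 dim S - dim Z - 1` would be missing. -/
theorem gap_stabilizer_top {S W Z : Submodule K L} {F : IntermediateField K L}
    (hS : FullSpectrum S) (hFZ : F ≤ stabilizer Z)
    (hW : 0 < Module.finrank K W)
    (hFW : F ≤ stabilizer W)
    (hdim : Module.finrank K Z = Module.finrank K W + Module.finrank K F)
    (hWS : W < S) (hSZ : S < Z) : stabilizer Z = F := by
  by_contra hne
  have hlt : F < stabilizer Z := lt_of_le_of_ne hFZ (Ne.symm hne)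
  have h2 : 2 * Module.finrank K F ≤ Module.finrank K (stabilizer Z) := by
    have := finrank_add_le_of_lt (U := F.toSubalgebra.toSubmodule)
      (V := (stabilizer Z).toSubalgebra.toSubmodule) (F := F)
      (fun f hf u hu => mul_mem (S := IntermediateField K L) hf hu)
      (fun f hf u hu => mul_mem (S := IntermediateField K L) (hFZ hf) hu) hlt
    change Module.finrank K F + Module.finrank K F ≤ Module.finrank K (stabilizer Z) at this
    omega
  have hWdvd := Nat.le_of_dvd hW (finrank_dvd_of_le_stabilizer hFW)
  have a1 := Submodule.finrank_lt_finrank_of_lt hWS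
  have c1 := Submodule.finrank_lt_finrank_of_lt hSZ
  obtain ⟨γ, hγ⟩ := hS (2 * Module.finrank K S - Module.finrank K Z - 1) (by omega)
  by_cases hγZ : γ ∈ stabilizer Z
  · have := two_mul_finrank_le_slice hSZ.le hγZ
    omega
  · have := finrank_slice_add_le le_rfl hγZ
    have h3 := Submodule.finrank_mono (slice_mono hSZ.le γ)
    omega

/-- If `W` were stable under a field larger than `F`, the value `dim W - 1` would be missing: the
multipliers stabilizing `W` give at least `dim W`, and all others lose `2 [F : K]` inside `W`. -/
theorem gap_stabilizer_bot {S W Z : Submodule K L} {F : IntermediateField K L}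
    (hS : FullSpectrum S)
    (hW : 0 < Module.finrank K W)
    (hFW : F ≤ stabilizer W)
    (hdim : Module.finrank K Z = Module.finrank K W + Module.finrank K F)
    (hWS : W < S) (hSZ : S < Z) : stabilizer W = F := by
  by_contra hne
  have hlt : F < stabilizer W := lt_of_le_of_ne hFW (Ne.symm hne)
  have h2 : 2 * Module.finrank K F ≤ Module.finrank K (stabilizer W) := by
    have := finrank_add_le_of_lt (U := F.toSubalgebra.toSubmodule)
      (V := (stabilizer W).toSubalgebra.toSubmodule) (F := F)
      (fun f hf u hu => mul_mem (S := IntermediateField K L) hf hu)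
      (fun f hf u hu => mul_mem (S := IntermediateField K L) (hFW hf) hu) hlt
    change Module.finrank K F + Module.finrank K F ≤ Module.finrank K (stabilizer W) at this
    omega
  have a1 := Submodule.finrank_lt_finrank_of_lt hWS
  have c1 := Submodule.finrank_lt_finrank_of_lt hSZ
  obtain ⟨γ, hγ⟩ := hS (Module.finrank K W - 1) (by omega)
  by_cases hγW : γ ∈ stabilizer W
  · have : W ≤ slice S γ := fun x hx => ⟨hWS.le hx, hWS.le (hγW x hx)⟩
    have := Submodule.finrank_mono this
    omega
  · have := finrank_slice_add_le le_rfl hγW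
    have h3 := finrank_slice_le_of_le hWS.le (γ := γ) (fun h => hγW (h ▸ zero_mem _))
    omega

/-- The main dimension count: a space of full spectrum caught strictly between two consecutive
nonzero `F`-subspaces `W` and `Z` forces `[F : K] = 2`. With `a = dim S - dim W` and
`c = dim Z - dim S`, multipliers in `F` give dimensions at least `dim S - min a c`, and those
outside `F`, which stabilize neither `W` nor `Z`, give at most `dim W - c`; the value next to
`dim S - min a c` is attained only if `a = c = 1`. -/
theorem gap {S W Z : Submodule K L} {F : IntermediateField K L}
    (hS : FullSpectrum S)
    (hW : 0 < Module.finrank K W)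
    (hFW : F ≤ stabilizer W) (hFZ : F ≤ stabilizer Z)
    (hdim : Module.finrank K Z = Module.finrank K W + Module.finrank K F)
    (hWS : W < S) (hSZ : S < Z) :
    Module.finrank K F = 2 ∧ Module.finrank K S = Module.finrank K W + 1 ∧
      ∃ β ∉ F, Module.finrank K (slice W β) + 2 = Module.finrank K W ∧
        Module.finrank K (slice Z β) + 2 = Module.finrank K Z := by
  have hM := gap_stabilizer_bot hS hW hFW hdim hWS hSZ
  have hN := gap_stabilizer_top hS hFZ hW hFW hdim hWS hSZ
  have a1 := Submodule.finrank_lt_finrank_of_lt hWS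
  have c1 := Submodule.finrank_lt_finrank_of_lt hSZ
  -- the first value below those that multipliers in `F` can give
  obtain ⟨γ, hγ⟩ := hS (Module.finrank K S - min (Module.finrank K S - Module.finrank K W)
    (Module.finrank K Z - Module.finrank K S) - 1) (by omega)
  have hWt := Nat.le_of_dvd hW (finrank_dvd_of_le_stabilizer hFW)
  have hγF : γ ∉ F := by
    intro h
    have h1 := two_mul_finrank_le_slice hSZ.le (hFZ h)
    have h2 : W ≤ slice S γ := fun x hx => ⟨hWS.le hx, hWS.le (hFW h x hx)⟩
    have := Submodule.finrank_mono h2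
    omega
  have h0 : γ ≠ 0 := fun h => hγF (h ▸ zero_mem _)
  have hWγ := finrank_slice_add_le hFW (hM ▸ hγF)
  have hZγ := finrank_slice_add_le hFZ (hN ▸ hγF)
  have hSW := finrank_slice_le_of_le hWS.le h0
  have hSZ' := Submodule.finrank_mono (slice_mono hSZ.le γ)
  have hcW := finrank_comap_mulLeft W h0
  have hcS := finrank_comap_mulLeft S h0
  have hY := le_stabilizer_slice hFZ γ
  -- If `slice Z γ` is not inside `W` (or not inside `γ⁻¹ W`), it meets it in an `F`-subspace of
  -- smaller dimension, and `S` has codimension `dim S - dim W` over `W`.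
  have key : Module.finrank K (slice S γ) + Module.finrank K F ≤ Module.finrank K S ∨
      Module.finrank K (slice Z γ) + Module.finrank K F ≤ Module.finrank K W := by
    by_cases h1 : slice Z γ ≤ W
    · by_cases h2 : slice Z γ ≤ W.comap (LinearMap.mulLeft K γ)
      · right
        have h3 : slice Z γ ≤ slice W γ := le_inf h1 h2
        have := Submodule.finrank_mono h3
        omega
      · left
        have h3 : slice Z γ ⊓ W.comap (LinearMap.mulLeft K γ) < slice Z γ :=
          lt_of_le_of_ne inf_le_left fun h => h2 (inf_eq_left.mp h)
        have h4 := finrank_add_le_of_lt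
          (le_stabilizer_inf hY (le_stabilizer_comap hFW γ)) hY h3
        have h5 := finrank_add_finrank_le_inf (S := S.comap (LinearMap.mulLeft K γ))
          (X := slice S γ) (Y := W.comap (LinearMap.mulLeft K γ)) inf_le_right
          (Submodule.comap_mono hWS.le)
        have h6 := Submodule.finrank_mono
          (inf_le_inf_right (W.comap (LinearMap.mulLeft K γ)) (slice_mono hSZ.le γ))
        omega
    · left
      have h3 : slice Z γ ⊓ W < slice Z γ :=
        lt_of_le_of_ne inf_le_left fun h => h1 (inf_eq_left.mp h)
      have h4 := finrank_add_le_of_lt (le_stabilizer_inf hY hFW) hY h3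
      have h5 := finrank_add_finrank_le_inf (slice_le S γ) hWS.le
      have h6 := Submodule.finrank_mono (inf_le_inf_right W (slice_mono hSZ.le γ))
      omega
  have h2 : Module.finrank K F = 2 := by omega
  refine ⟨h2, by omega, γ, hγF, ?_, ?_⟩
  · obtain ⟨a, ha⟩ := finrank_dvd_of_le_stabilizer hFW
    obtain ⟨b, hb⟩ := finrank_dvd_of_le_stabilizer (le_stabilizer_slice hFW γ)
    rw [h2] at ha hb
    omega
  · obtain ⟨a, ha⟩ := finrank_dvd_of_le_stabilizer hFZ
    obtain ⟨b, hb⟩ := finrank_dvd_of_le_stabilizer (le_stabilizer_slice hFZ γ)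
    rw [h2] at ha hb
    omega

end Slice

/-! ### Spans of powers and pencils -/

section Pencil

open Polynomial IntermediateField

variable {K L : Type*} [Field K] [Field L] [Algebra K L]

/-- The `K`-span of `b, x b, …, x ^ (r - 1) b`, as the image of the polynomials of degree less than
`r` under `p ↦ p(x) b`. -/
noncomputable def powSpan (K : Type*) {L : Type*} [Field K] [Field L] [Algebra K L] (x b : L)
    (r : ℕ) : Submodule K L :=
  (degreeLT K r).map (LinearMap.mulRight K b ∘ₗ (aeval x).toLinearMap)

theorem mem_powSpan {x b y : L} {r : ℕ} :
    y ∈ powSpan K x b r ↔ ∃ p : K[X], p.degree < r ∧ aeval x p * b = y := by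
  simp [powSpan, mem_degreeLT]

theorem pow_mul_mem_powSpan {x b : L} {i r : ℕ} (h : i < r) : x ^ i * b ∈ powSpan K x b r :=
  mem_powSpan.mpr ⟨X ^ i, by rw [degree_X_pow]; exact_mod_cast h, by simp⟩

theorem powSpan_le {x b : L} {r : ℕ} {U : Submodule K L} :
    powSpan K x b r ≤ U ↔ ∀ i < r, x ^ i * b ∈ U := by
  refine ⟨fun h i hi => h (pow_mul_mem_powSpan hi), fun h => ?_⟩
  classical
  rw [powSpan, Submodule.map_le_iff_le_comap, degreeLT_eq_span_X_pow, Submodule.span_le]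
  intro p hp
  obtain ⟨i, hi, rfl⟩ : ∃ i < r, X ^ i = p := by simpa using hp
  simpa using h i hi

theorem powSpan_eq_span (x b : L) (r : ℕ) :
    powSpan K x b r = Submodule.span K {y | ∃ i < r, y = x ^ i * b} := by
  refine le_antisymm (powSpan_le.mpr fun i hi => Submodule.subset_span ⟨i, hi, rfl⟩) ?_
  rw [Submodule.span_le]
  rintro _ ⟨i, hi, rfl⟩
  exact pow_mul_mem_powSpan hi

theorem powSpan_mono (x b : L) {r s : ℕ} (h : r ≤ s) : powSpan K x b r ≤ powSpan K x b s :=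
  powSpan_le.mpr fun _ hi => pow_mul_mem_powSpan (hi.trans_le h)

theorem powSpan_succ (x b : L) (r : ℕ) :
    powSpan K x b (r + 1) = powSpan K x b r ⊔ Submodule.span K {x ^ r * b} := by
  refine le_antisymm (powSpan_le.mpr fun i hi => ?_) (sup_le (powSpan_mono x b r.le_succ) ?_)
  · rcases Nat.lt_succ_iff_lt_or_eq.mp hi with h | rfl
    · exact Submodule.mem_sup_left (pow_mul_mem_powSpan h)
    · exact Submodule.mem_sup_right (Submodule.mem_span_singleton_self _)
  · rw [Submodule.span_singleton_le_iff_mem]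
    exact pow_mul_mem_powSpan r.lt_succ_self

theorem mul_mem_powSpan_succ {x b y : L} {r : ℕ} (h : y ∈ powSpan K x b r) :
    x * y ∈ powSpan K x b (r + 1) := by
  have : powSpan K x b r ≤ (powSpan K x b (r + 1)).comap (LinearMap.mulLeft K x) := by
    refine powSpan_le.mpr fun i hi => ?_
    simpa [Submodule.mem_comap, ← mul_assoc, ← pow_succ'] using
      (pow_mul_mem_powSpan (by omega) : x ^ (i + 1) * b ∈ powSpan K x b (r + 1))
  exact this h

/-- The one-dimensional `F`-subspace `b F`, as a `K`-subspace. -/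
noncomputable def mulField (F : IntermediateField K L) (b : L) : Submodule K L :=
  F.toSubalgebra.toSubmodule.map (LinearMap.mulRight K b)

theorem mem_mulField {F : IntermediateField K L} {b y : L} :
    y ∈ mulField F b ↔ ∃ f ∈ F, f * b = y := by
  simp [mulField]

theorem finrank_mulField (F : IntermediateField K L) {b : L} (hb : b ≠ 0) :
    Module.finrank K (mulField F b) = Module.finrank K F :=
  (F.toSubalgebra.toSubmodule.equivMapOfInjective (LinearMap.mulRight K b)
    fun _ _ h => mul_right_cancel₀ hb h).finrank_eq.symm

theorem powSpan_le_mulField (x b : L) (r : ℕ) : powSpan K x b r ≤ mulField K⟮x⟯ b :=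
  powSpan_le.mpr fun i _ =>
    mem_mulField.mpr ⟨x ^ i, pow_mem (mem_adjoin_simple_self K x) i, rfl⟩

theorem slice_eq_bot {S : Submodule K L} {F : IntermediateField K L} {b γ : L}
    (hSb : S ≤ mulField F b) (hγ : γ ∉ F) : slice S γ = ⊥ := by
  rw [eq_bot_iff]
  intro y hy
  obtain ⟨f, hf, rfl⟩ := mem_mulField.mp (hSb hy.1)
  obtain ⟨g, hg, hgf⟩ := mem_mulField.mp (hSb hy.2)
  by_contra hne
  obtain ⟨h0, hb⟩ := mul_ne_zero_iff.mp (show f * b ≠ 0 from hne)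
  have h2 : g * b = γ * f * b := by rw [hgf]; simp [mul_assoc]
  refine hγ ?_
  rw [show γ = g / f by rw [mul_right_cancel₀ hb h2, mul_div_cancel_right₀ _ h0]]
  exact div_mem hg hf

variable [FiniteDimensional K L]

theorem eq_zero_of_aeval_eq_zero {x : L} {p : K[X]} (hp : p.degree < Module.finrank K K⟮x⟯)
    (h : aeval x p = 0) : p = 0 := by
  have hx : IsIntegral K x := IsIntegral.of_finite K x
  by_contra hne
  rw [adjoin.finrank hx] at hp
  have := minpoly.degree_le_of_ne_zero K x hne h
  rw [degree_eq_natDegree (minpoly.ne_zero hx)] at this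
  exact absurd hp (not_lt.mpr this)

theorem eq_of_aeval_eq {x : L} {p q : K[X]} (hp : p.degree < Module.finrank K K⟮x⟯)
    (hq : q.degree < Module.finrank K K⟮x⟯) (h : aeval x p = aeval x q) : p = q := by
  rw [← sub_eq_zero]
  refine eq_zero_of_aeval_eq_zero ((degree_sub_le p q).trans_lt (max_lt hp hq)) ?_
  rw [map_sub, h, sub_self]

theorem finrank_powSpan {x b : L} {r : ℕ} (hb : b ≠ 0) (hr : r ≤ Module.finrank K K⟮x⟯) :
    Module.finrank K (powSpan K x b r) = r := by
  have hinj : Function.Injective ((LinearMap.mulRight K b ∘ₗ (aeval x).toLinearMap).domRestrict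
      (degreeLT K r)) := by
    rintro ⟨p, hp⟩ ⟨q, hq⟩ h
    rw [mem_degreeLT] at hp hq
    have hr' : (r : WithBot ℕ) ≤ Module.finrank K K⟮x⟯ := by exact_mod_cast hr
    exact Subtype.ext (eq_of_aeval_eq (hp.trans_le hr') (hq.trans_le hr')
      (mul_right_cancel₀ hb h))
  rw [powSpan, ← LinearMap.range_domRestrict, LinearMap.finrank_range_of_inj hinj,
    (degreeLTEquiv K r).finrank_eq, Module.finrank_fin_fun]

theorem adjoin_le_stabilizer {x : L} {U : Submodule K L} (h : x ∈ stabilizer U) :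
    K⟮x⟯ ≤ stabilizer U := by
  rwa [adjoin_simple_le_iff]

/-- Division by the minimal polynomial: a span of at least `[K(x) : K]` powers is stable. -/
theorem mem_stabilizer_powSpan {x b : L} {r : ℕ} (hr : Module.finrank K K⟮x⟯ ≤ r) :
    x ∈ stabilizer (powSpan K x b r) := by
  have hx : IsIntegral K x := IsIntegral.of_finite K x
  rw [adjoin.finrank hx] at hr
  intro y hy
  obtain ⟨p, hp, rfl⟩ := mem_powSpan.mp hy
  refine mem_powSpan.mpr ⟨(X * p) %ₘ minpoly K x, ?_, ?_⟩
  · refine (degree_modByMonic_lt _ (minpoly.monic hx)).trans_le ?_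
    rw [degree_eq_natDegree (minpoly.ne_zero hx)]
    exact_mod_cast hr
  · rw [← aeval_modByMonic_eq_self_of_root (minpoly.aeval K x)]
    simp [mul_assoc]

theorem eq_sup_span_singleton {S T : Submodule K L} {v : L} (hT : T ≤ S) (hv : v ∈ S)
    (hvT : v ∉ T) (h : Module.finrank K S ≤ Module.finrank K T + 1) :
    T ⊔ Submodule.span K {v} = S := by
  have hle : T ⊔ Submodule.span K {v} ≤ S :=
    sup_le hT ((Submodule.span_singleton_le_iff_mem _ _).mpr hv)
  refine Submodule.eq_of_le_of_finrank_le hle ?_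
  have hlt : T < T ⊔ Submodule.span K {v} := lt_of_le_of_ne le_sup_left fun he =>
    hvT (he ▸ Submodule.mem_sup_right (Submodule.mem_span_singleton_self v))
  have := Submodule.finrank_lt_finrank_of_lt hlt
  omega

/-- Kronecker's pencil argument. If the vectors of `S` that `α` keeps in `S` form a hyperplane `S₁`
of `S`, then either `S₁` is `α`-stable, or it satisfies the same hypothesis and is smaller; in the
second case the chain of powers found in `S₁` extends by one more vector, which lies in `S` and not
in `S₁`. -/
theorem exists_pencil_aux (α : L) (m : ℕ) : ∀ S : Submodule K L, Module.finrank K S = m →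
    Module.finrank K (slice S α) + 1 = Module.finrank K S →
    ∃ W ≤ S, α ∈ stabilizer W ∧ (∀ U ≤ S, α ∈ stabilizer U → U ≤ W) ∧
      ∃ (b : L) (r : ℕ), 1 ≤ r ∧ W ⊔ powSpan K α b r = S ∧
        Module.finrank K S = Module.finrank K W + r := by
  induction m with
  | zero => intro S h1 h2; omega
  | succ m ih =>
    intro S hm hS
    have hstab : ∀ U ≤ S, α ∈ stabilizer U → U ≤ slice S α :=
      fun U hU hα x hx => ⟨hU hx, hU (hα x hx)⟩
    by_cases hα : α ∈ stabilizer (slice S α)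
    · obtain ⟨b, hb, hb'⟩ : ∃ b ∈ S, b ∉ slice S α := by
        by_contra! hcon
        have := Submodule.finrank_mono (show S ≤ slice S α from hcon)
        omega
      refine ⟨slice S α, slice_le _ _, hα, hstab, b, 1, le_rfl, ?_, hS.symm⟩
      rw [show (1 : ℕ) = 0 + 1 from rfl, powSpan_succ]
      have h0 : powSpan K α b 0 = ⊥ := by
        rw [eq_bot_iff]; exact powSpan_le.mpr fun i hi => absurd hi (Nat.not_lt_zero _)
      rw [h0, bot_sup_eq, pow_zero, one_mul]
      exact eq_sup_span_singleton (slice_le _ _) hb hb' hS.ge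
    · have hlt : slice (slice S α) α < slice S α := by
        refine lt_of_le_of_ne (slice_le _ _) fun he => hα fun u hu => ?_
        rw [← he] at hu
        exact hu.2
      have h1 := Submodule.finrank_lt_finrank_of_lt hlt
      have h2 : Module.finrank K (slice S α) ≤ Module.finrank K (slice (slice S α) α) + 1 := by
        rcases eq_or_ne α 0 with h0 | h0
        · exact absurd (h0 ▸ zero_mem _) hα
        have h4 := finrank_add_finrank_le_inf (X := slice S α)
          (Y := (slice S α).comap (LinearMap.mulLeft K α))
          (S := S.comap (LinearMap.mulLeft K α)) (fun x hx => hx.2)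
          (Submodule.comap_mono (slice_le _ _))
        rw [finrank_comap_mulLeft _ h0, finrank_comap_mulLeft _ h0] at h4
        change _ ≤ Module.finrank K (slice (slice S α) α) + _ at h4
        omega
      obtain ⟨W, hW, hWα, hmax, b, r, hr, hsup, hdim⟩ := ih (slice S α) (by omega) (by omega)
      have hb : ∀ i < r, α ^ i * b ∈ slice S α := fun i hi =>
        hsup ▸ Submodule.mem_sup_right (pow_mul_mem_powSpan hi)
      have hbS : α ^ r * b ∈ S := by
        obtain ⟨i, rfl⟩ : ∃ i, r = i + 1 := ⟨r - 1, by omega⟩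
        rw [pow_succ', mul_assoc]
        exact (hb i (by omega)).2
      have hbn : α ^ r * b ∉ slice S α := by
        intro hmem
        refine hα fun u hu => ?_
        rw [← hsup] at hu
        obtain ⟨w, hw, y, hy, rfl⟩ := Submodule.mem_sup.mp hu
        rw [mul_add]
        refine add_mem (hW (hWα w hw)) ?_
        refine (powSpan_le.mpr fun i hi => ?_ : powSpan K α b (r + 1) ≤ _)
          (mul_mem_powSpan_succ hy)
        rcases Nat.lt_succ_iff_lt_or_eq.mp hi with h | rfl
        · exact hb i h
        · exact hmem
      refine ⟨W, hW.trans (slice_le _ _), hWα, fun U hU hUα => hmax U (hstab U hU hUα) hUα,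
        b, r + 1, by omega, ?_, by omega⟩
      rw [powSpan_succ, ← sup_assoc, hsup]
      exact eq_sup_span_singleton (slice_le _ _) hbS hbn hS.ge

/-- If `α` keeps a hyperplane of `S` in `S`, then `S` is the direct sum (by the dimension formula)
of its largest `K(α)`-subspace `W` and the span of `b, α b, …, α ^ (r - 1) b`. -/
theorem exists_pencil {α : L} {S : Submodule K L}
    (hS : Module.finrank K (slice S α) + 1 = Module.finrank K S) :
    ∃ W ≤ S, α ∈ stabilizer W ∧ (∀ U ≤ S, α ∈ stabilizer U → U ≤ W) ∧
      ∃ (b : L) (r : ℕ), 1 ≤ r ∧ r < Module.finrank K K⟮α⟯ ∧ W ⊔ powSpan K α b r = S ∧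
        Module.finrank K S = Module.finrank K W + r := by
  obtain ⟨W, hW, hWα, hmax, b, r, hr, hsup, hdim⟩ := exists_pencil_aux α _ S rfl hS
  refine ⟨W, hW, hWα, hmax, b, r, hr, ?_, hsup, hdim⟩
  by_contra! hcon
  have h1 : powSpan K α b r ≤ W :=
    hmax _ (hsup ▸ le_sup_right) (mem_stabilizer_powSpan hcon)
  rw [sup_eq_left.mpr h1] at hsup
  rw [hsup] at hdim
  omega

theorem le_stabilizer_mulField (F : IntermediateField K L) (b : L) :
    F ≤ stabilizer (mulField F b) := by
  intro f hf u hu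
  obtain ⟨g, hg, rfl⟩ := mem_mulField.mp hu
  exact mem_mulField.mpr ⟨f * g, mul_mem hf hg, mul_assoc _ _ _⟩

theorem le_stabilizer_sup {F : IntermediateField K L} {U V : Submodule K L}
    (hU : F ≤ stabilizer U) (hV : F ≤ stabilizer V) : F ≤ stabilizer (U ⊔ V) := by
  intro f hf u hu
  obtain ⟨x, hx, y, hy, rfl⟩ := Submodule.mem_sup.mp hu
  rw [mul_add]
  exact Submodule.add_mem_sup (hU hf x hx) (hV hf y hy)

theorem finrank_sup_mulField {F : IntermediateField K L} {W : Submodule K L} {b : L}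
    (hW : F ≤ stabilizer W) (hb : b ∉ W) :
    Module.finrank K (W ⊔ mulField F b : Submodule K L) =
      Module.finrank K W + Module.finrank K F := by
  have h := Submodule.finrank_sup_add_finrank_inf_eq W (mulField F b)
  have hinf : W ⊓ mulField F b = ⊥ := by
    rw [eq_bot_iff]
    rintro y ⟨hy, hy'⟩
    obtain ⟨f, hf, rfl⟩ := mem_mulField.mp hy'
    rcases eq_or_ne f 0 with rfl | h0
    · simp
    · refine absurd ?_ hb
      simpa [inv_mul_cancel_left₀ h0] using hW (inv_mem hf) _ hy
  rw [hinf, finrank_bot, finrank_mulField F (by rintro rfl; exact hb (zero_mem _))] at h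
  simpa using h

/-- A space of full spectrum inside `b F` has small dimension: elements outside `F` give trivial
intersections, so the value `1` is attained inside `F`, where the dimension formula bounds the
intersection from below. -/
theorem two_mul_finrank_le_of_le_mulField {S : Submodule K L} {F : IntermediateField K L} {b : L}
    (hS : FullSpectrum S) (h1 : 1 < Module.finrank K S) (hSb : S ≤ mulField F b) :
    2 * Module.finrank K S ≤ Module.finrank K F + 1 := by
  obtain ⟨γ, hγ⟩ := hS 1 h1
  have hγF : γ ∈ F := by
    by_contra hγF
    rw [slice_eq_bot hSb hγF, finrank_bot] at hγ
    omega
  have h2 := two_mul_finrank_le_slice hSb (le_stabilizer_mulField F b hγF)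
  have h3 : Module.finrank K (mulField F b) ≤ Module.finrank K F :=
    Submodule.finrank_map_le _ _
  omega

end Pencil

/-! ### Spaces of full spectrum belong to the two families -/

section Moebius

open Polynomial IntermediateField

variable {K L : Type*} [Field K] [Field L] [Algebra K L]

theorem powSpan_smul {x b : L} {r : ℕ} {e : K} (he : e ≠ 0) :
    powSpan K x (e • b) r = powSpan K x b r := by
  refine le_antisymm (powSpan_le.mpr fun i hi => ?_) (powSpan_le.mpr fun i hi => ?_)
  · rw [mul_smul_comm]
    exact Submodule.smul_mem _ _ (pow_mul_mem_powSpan hi)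
  · rw [← inv_smul_smul₀ he (x ^ i * b), ← mul_smul_comm]
    exact Submodule.smul_mem _ _ (pow_mul_mem_powSpan hi)

/-- Read backwards, the powers of `u` are powers of `u⁻¹`. -/
theorem powSpan_inv {u b : L} (hu : u ≠ 0) (r : ℕ) :
    powSpan K u b (r + 1) = powSpan K u⁻¹ (u ^ r * b) (r + 1) := by
  have key : ∀ i ≤ r, u⁻¹ ^ i * (u ^ r * b) = u ^ (r - i) * b := by
    intro i hi
    obtain ⟨j, rfl⟩ := Nat.exists_eq_add_of_le hi
    rw [Nat.add_sub_cancel_left, pow_add, mul_assoc, inv_pow,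
      inv_mul_cancel_left₀ (pow_ne_zero i hu)]
  refine le_antisymm (powSpan_le.mpr fun i hi => ?_) (powSpan_le.mpr fun i hi => ?_)
  · have := key (r - i) (Nat.sub_le _ _)
    rw [Nat.sub_sub_self (Nat.lt_succ_iff.mp hi)] at this
    rw [← this]
    exact pow_mul_mem_powSpan (by omega)
  · rw [key i (Nat.lt_succ_iff.mp hi)]
    exact pow_mul_mem_powSpan (by omega)

theorem adjoin_affine {x : L} {p₀ p₁ : K} (h : p₁ ≠ 0) : K⟮p₁ • x + algebraMap K L p₀⟯ = K⟮x⟯ := by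
  refine le_antisymm ?_ ?_
  · rw [adjoin_simple_le_iff]
    exact add_mem (IntermediateField.smul_mem _ (mem_adjoin_simple_self K x))
      (IntermediateField.algebraMap_mem _ _)
  · rw [adjoin_simple_le_iff]
    have h1 : x = p₁⁻¹ • ((p₁ • x + algebraMap K L p₀) - algebraMap K L p₀) := by
      rw [add_sub_cancel_right, inv_smul_smul₀ h]
    have h2 := mem_adjoin_simple_self K (p₁ • x + algebraMap K L p₀)
    have h3 := IntermediateField.smul_mem _ (x := p₁⁻¹)
      (sub_mem h2 (IntermediateField.algebraMap_mem K⟮p₁ • x + algebraMap K L p₀⟯ p₀))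
    rwa [← h1] at h3

theorem adjoin_inv (x : L) : K⟮x⁻¹⟯ = K⟮x⟯ := by
  refine le_antisymm ?_ ?_
  · rw [adjoin_simple_le_iff]
    exact inv_mem (mem_adjoin_simple_self K x)
  · rw [adjoin_simple_le_iff]
    have := inv_mem (mem_adjoin_simple_self K x⁻¹)
    rwa [inv_inv] at this

variable [FiniteDimensional K L]

theorem powSpan_affine {x b : L} {p₀ p₁ : K} (h : p₁ ≠ 0) {r : ℕ} (hb : b ≠ 0)
    (hr : r ≤ Module.finrank K K⟮x⟯) :
    powSpan K x b r = powSpan K (p₁ • x + algebraMap K L p₀) b r := by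
  refine (Submodule.eq_of_le_of_finrank_le (powSpan_le.mpr fun i hi => mem_powSpan.mpr
    ⟨(C p₁ * X + C p₀) ^ i, ?_, ?_⟩) ?_).symm
  · rw [degree_pow, degree_linear h]
    simpa using hi
  · simp [Algebra.smul_def]
  · rw [finrank_powSpan hb hr, finrank_powSpan hb (by rwa [adjoin_affine h])]

/-- Two consecutive spans of powers of `x`, one inside the other, are consecutive spans
`⟨c, y c, …⟩` with the same `c` and a common `y`. The inclusion forces `b₁ = (p₁ x + p₀) b₂`; for
`p₁ ≠ 0` the smaller span consists of the multiples of `p₁ x + p₀` rather than of the polynomials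
of lower degree, and `y = (p₁ x + p₀)⁻¹` moves the root of that factor to infinity. -/
theorem exists_common_powSpan {x b₁ b₂ : L} {w : ℕ} (hw : 1 ≤ w)
    (hw' : w + 1 < Module.finrank K K⟮x⟯) (hb₁ : b₁ ≠ 0)
    (hle : powSpan K x b₁ w ≤ powSpan K x b₂ (w + 1)) :
    ∃ y c : L, c ≠ 0 ∧ K⟮y⟯ = K⟮x⟯ ∧ powSpan K x b₁ w = powSpan K y c w ∧
      powSpan K x b₂ (w + 1) = powSpan K y c (w + 1) := by
  have hmem : ∀ i < w, ∃ q : K[X], q.degree < (w + 1 : ℕ) ∧ aeval x q * b₂ = x ^ i * b₁ :=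
    fun i hi => mem_powSpan.mp (hle (pow_mul_mem_powSpan hi))
  obtain ⟨p, hp, hpb⟩ := hmem 0 (by omega)
  rw [pow_zero, one_mul] at hpb
  have hb₂ : b₂ ≠ 0 := by rintro rfl; rw [mul_zero] at hpb; exact hb₁ hpb.symm
  have hp0 : p ≠ 0 := by rintro rfl; rw [map_zero, zero_mul] at hpb; exact hb₁ hpb.symm
  -- no power of `X` used here makes the degree of `p` reach `[K(x) : K]`
  have hdeg : ∀ i < w, (X ^ i * p).degree < ((w + 1 : ℕ) : WithBot ℕ) := by
    intro i
    induction i with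
    | zero => intro _; simpa using hp
    | succ i ih =>
      intro hi
      have h1 := ih (by omega)
      obtain ⟨q, hq, hqb⟩ := hmem (i + 1) hi
      have hτ : ((w + 1 : ℕ) : WithBot ℕ) < Module.finrank K K⟮x⟯ := by exact_mod_cast hw'
      have : X ^ (i + 1) * p = q := by
        refine eq_of_aeval_eq (x := x) ?_ (hq.trans hτ) ?_
        · rw [degree_eq_natDegree (mul_ne_zero (pow_ne_zero _ X_ne_zero) hp0)] at h1 ⊢
          rw [natDegree_X_pow_mul _ hp0] at h1 ⊢
          have h2 : p.natDegree + i < w + 1 := by exact_mod_cast h1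
          exact_mod_cast (by omega : p.natDegree + (i + 1) < Module.finrank K K⟮x⟯)
        · refine mul_right_cancel₀ hb₂ ?_
          rw [hqb, map_mul, mul_assoc, hpb, map_pow, aeval_X]
      rw [this]
      exact hq
  have hnat : p.natDegree ≤ 1 := by
    have h1 := hdeg (w - 1) (by omega)
    rw [degree_eq_natDegree (mul_ne_zero (pow_ne_zero _ X_ne_zero) hp0),
      natDegree_X_pow_mul _ hp0] at h1
    have h2 : p.natDegree + (w - 1) < w + 1 := by exact_mod_cast h1
    omega
  obtain ⟨p₁, p₀, rfl⟩ := exists_eq_X_add_C_of_natDegree_le_one hnat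
  by_cases h1 : p₁ = 0
  · subst h1
    have hpb' : b₁ = p₀ • b₂ := by rw [← hpb]; simp [Algebra.smul_def]
    have h0 : p₀ ≠ 0 := by rintro rfl; exact hb₁ (by rw [hpb', zero_smul])
    exact ⟨x, b₂, hb₂, rfl, by rw [hpb', powSpan_smul h0], rfl⟩
  · set u := p₁ • x + algebraMap K L p₀ with hu
    have hpb' : b₁ = u * b₂ := by rw [← hpb, hu]; simp [Algebra.smul_def]
    have hu0 : u ≠ 0 := by rintro h; exact hb₁ (by rw [hpb', h, zero_mul])
    refine ⟨u⁻¹, u ^ w * b₂, mul_ne_zero (pow_ne_zero _ hu0) hb₂, ?_, ?_, ?_⟩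
    · rw [adjoin_inv, hu, adjoin_affine h1]
    · obtain ⟨v, rfl⟩ : ∃ v, w = v + 1 := ⟨w - 1, by omega⟩
      rw [powSpan_affine (p₀ := p₀) h1 hb₁ (by omega), ← hu, powSpan_inv hu0, hpb', ← mul_assoc,
        ← pow_succ]
    · rw [powSpan_affine (p₀ := p₀) h1 hb₂ (by omega), ← hu, powSpan_inv hu0]

end Moebius

section Descent

open IntermediateField

variable {K L : Type*} [Field K] [Field L] [Algebra K L]

theorem restrictScalars_mulField (E : IntermediateField K L) (β b : L) :
    (mulField E⟮β⟯ b).restrictScalars K = mulField (E⟮β⟯.restrictScalars K) b := by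
  ext y
  rw [Submodule.restrictScalars_mem, mem_mulField, mem_mulField]
  rfl

theorem exists_family_one {S : Submodule K L} {x b : L} {k : ℕ} (hb : b ≠ 0)
    (hx : x ∉ Set.range (algebraMap K L)) (h1 : 2 * k ≤ Module.finrank K K⟮x⟯ + 1)
    (h2 : 2 * k ≤ Module.finrank K L) (hS : S = powSpan K x b k) :
    ∃ c ≠ 0, ∃ T : Submodule K L, T.map (LinearMap.mulLeft K c) = S ∧ IsFamilyOne k T := by
  refine ⟨b, hb, powSpan K x 1 k, ?_, x, hx, fun _ => ?_, fun _ => ?_, ?_⟩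
  · rw [hS]
    ext y
    simp only [Submodule.mem_map, LinearMap.mulLeft_apply, mem_powSpan, mul_one]
    constructor
    · rintro ⟨_, ⟨p, hp, rfl⟩, rfl⟩
      exact ⟨p, hp, mul_comm _ _⟩
    · rintro ⟨p, hp, rfl⟩
      exact ⟨_, ⟨p, hp, rfl⟩, mul_comm _ _⟩
  · rw [le_div_iff₀ two_pos, mul_comm]
    exact_mod_cast h1
  · rw [le_div_iff₀ two_pos, mul_comm]
    exact_mod_cast h2
  · rw [powSpan_eq_span]
    simp only [mul_one]

variable [FiniteDimensional K L]

/-- A `K`-subspace stable under `F`, as an `F`-subspace. -/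
def ofStable {F : IntermediateField K L} {U : Submodule K L} (h : F ≤ stabilizer U) :
    Submodule F L :=
  { U with smul_mem' := fun c x hx => h c.2 x hx }

theorem finrank_restrictScalars (F : IntermediateField K L) (U : Submodule F L) :
    Module.finrank K (U.restrictScalars K) = Module.finrank K F * Module.finrank F U :=
  (Module.finrank_mul_finrank K F U).symm

theorem finrank_ofStable {F : IntermediateField K L} {U : Submodule K L} (h : F ≤ stabilizer U) :
    Module.finrank K U = Module.finrank K F * Module.finrank F (ofStable h) :=
  finrank_restrictScalars F (ofStable h)

theorem finrank_slice_ofStable {F : IntermediateField K L} {U : Submodule K L}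
    (h : F ≤ stabilizer U) (γ : L) :
    Module.finrank K (slice U γ) = Module.finrank K F * Module.finrank F (slice (ofStable h) γ) :=
  finrank_restrictScalars F (slice (ofStable h) γ)

theorem two_mul_finrank_adjoin (E : IntermediateField K L) (β : L) :
    Module.finrank K (E⟮β⟯.restrictScalars K) = Module.finrank K E * Module.finrank E E⟮β⟯ :=
  (Module.finrank_mul_finrank K E E⟮β⟯).symm

theorem disjoint_powSpan {E : IntermediateField K L} {x : L} {l : ℕ} (hx : x ≠ 0)
    (hl : l < Module.finrank E E⟮x⟯) :
    Disjoint ((powSpan E x 1 l).restrictScalars K) (Submodule.span K {x ^ l}) := by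
  rw [Submodule.disjoint_span_singleton' (pow_ne_zero l hx)]
  intro hmem
  have h1 : powSpan E x 1 (l + 1) = powSpan E x 1 l := by
    rw [powSpan_succ, mul_one, sup_eq_left, Submodule.span_singleton_le_iff_mem]
    exact hmem
  have h2 := finrank_powSpan (K := E) (x := x) (b := 1) (r := l) one_ne_zero (by omega)
  rw [← h1, finrank_powSpan one_ne_zero (by omega)] at h2
  omega

/-- `E(β)` is too large a field for `gap`, so the `E(β)`-stable part has to vanish. -/
theorem eq_bot_of_adjoin_stable {S : Submodule K L} {E : IntermediateField K L}
    (hS : FullSpectrum S) (hE : Module.finrank K E = 2) {β b : L} {Z : Submodule E L}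
    (hτ : 1 < Module.finrank E E⟮β⟯) (hZβ : β ∈ stabilizer Z) (hb : b ∉ Z)
    (hZS : Z.restrictScalars K < S) (hSZ : S < (Z ⊔ mulField E⟮β⟯ b).restrictScalars K) :
    Z = ⊥ := by
  by_contra hne
  have hst := adjoin_le_stabilizer hZβ
  have hst' := le_stabilizer_sup hst (le_stabilizer_mulField _ b)
  have hpos : 0 < Module.finrank E Z := by
    rw [Nat.pos_iff_ne_zero, Ne, Submodule.finrank_eq_zero]
    exact hne
  have hdim : Module.finrank K ((Z ⊔ mulField E⟮β⟯ b).restrictScalars K) =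
      Module.finrank K (Z.restrictScalars K) + Module.finrank K (E⟮β⟯.restrictScalars K) := by
    rw [finrank_restrictScalars, finrank_restrictScalars, finrank_sup_mulField hst hb,
      two_mul_finrank_adjoin, mul_add]
  have hpos' : 0 < Module.finrank K (Z.restrictScalars K) := by
    rw [finrank_restrictScalars, hE]
    omega
  have h1 : E⟮β⟯.restrictScalars K ≤ stabilizer (Z.restrictScalars K) := fun f hf u hu =>
    hst hf u hu
  have h2 : E⟮β⟯.restrictScalars K ≤ stabilizer ((Z ⊔ mulField E⟮β⟯ b).restrictScalars K) :=
    fun f hf u hu => hst' hf u hu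
  have h3 := (gap hS hpos' h1 h2 hdim hZS hSZ).1
  rw [two_mul_finrank_adjoin, hE] at h3
  omega

/-- Decomposing `W` and `Z` as pencils over `E` with respect to the same `β`: their `E(β)`-stable
parts have the same dimension, since `dim_E Z = dim_E W + 1`, hence coincide, hence vanish, and `W`
and `Z` are spans of consecutive powers. -/
theorem exists_powSpan_of_slices {S W Z : Submodule K L} {E : IntermediateField K L}
    (hS : FullSpectrum S) (hE : Module.finrank K E = 2)
    (hEW : E ≤ stabilizer W) (hEZ : E ≤ stabilizer Z)
    (hdim : Module.finrank K Z = Module.finrank K W + 2)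
    (hdimS : Module.finrank K S = Module.finrank K W + 1)
    (hWS : W < S) (hSZ : S < Z) {β : L}
    (hWβ : Module.finrank K (slice W β) + 2 = Module.finrank K W)
    (hZβ : Module.finrank K (slice Z β) + 2 = Module.finrank K Z) :
    ∃ (y c : L) (l : ℕ), c ≠ 0 ∧ 1 ≤ l ∧ Module.finrank K S = 2 * l + 1 ∧
      Module.finrank K S ≤ Module.finrank E E⟮y⟯ ∧
      powSpan E y c l = ofStable hEW ∧ powSpan E y c (l + 1) = ofStable hEZ := by
  have dW := finrank_ofStable hEW
  have dZ := finrank_ofStable hEZ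
  have dW' := finrank_slice_ofStable hEW β
  have dZ' := finrank_slice_ofStable hEZ β
  rw [hE] at dW dZ dW' dZ'
  obtain ⟨W₁, hW₁, hW₁β, -, b₁, r₁, hr₁, hr₁τ, hsup₁, hdim₁⟩ :=
    exists_pencil (α := β) (S := ofStable hEW) (by omega)
  obtain ⟨Z₁, hZ₁, hZ₁β, hmax, b₂, r₂, hr₂, hr₂τ, hsup₂, hdim₂⟩ :=
    exists_pencil (α := β) (S := ofStable hEZ) (by omega)
  have hWZ : ofStable hEW ≤ ofStable hEZ := fun x hx => hSZ.le (hWS.le hx)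
  have hW₁Z₁ : W₁ = Z₁ := by
    refine Submodule.eq_of_le_of_finrank_le (hmax _ (hW₁.trans hWZ) hW₁β) ?_
    obtain ⟨a, ha⟩ := finrank_dvd_of_le_stabilizer (adjoin_le_stabilizer hW₁β)
    obtain ⟨b, hb⟩ := finrank_dvd_of_le_stabilizer (adjoin_le_stabilizer hZ₁β)
    by_contra! hlt
    rw [ha, hb] at hlt
    have h1 : a + 1 ≤ b := lt_of_mul_lt_mul_left hlt (Nat.zero_le _)
    have h2 := Nat.mul_le_mul_left (Module.finrank E E⟮β⟯) h1
    rw [mul_add, mul_one] at h2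
    omega
  have hb₂ : b₂ ∉ Z₁ := by
    intro hmem
    have : powSpan E β b₂ r₂ ≤ Z₁ :=
      powSpan_le.mpr fun i _ => (pow_mem hZ₁β i : β ^ i ∈ stabilizer Z₁) _ hmem
    rw [sup_eq_left.mpr this] at hsup₂
    rw [hsup₂] at hdim₂
    omega
  have hZ₁bot : Z₁ = ⊥ := by
    refine eq_bot_of_adjoin_stable hS hE (by omega) hZ₁β hb₂ (lt_of_le_of_lt ?_ hWS)
      (lt_of_lt_of_le hSZ ?_)
    · rw [← hW₁Z₁]
      exact fun x hx => hW₁ hx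
    · have h1 := sup_le_sup_left (powSpan_le_mulField (K := E) β b₂ r₂) Z₁
      rw [hsup₂] at h1
      exact fun x hx => h1 hx
  subst hW₁Z₁
  rw [hZ₁bot, finrank_bot, zero_add] at hdim₁ hdim₂
  rw [hZ₁bot, bot_sup_eq] at hsup₁ hsup₂
  obtain rfl : r₂ = r₁ + 1 := by omega
  have hb₁ : b₁ ≠ 0 := by
    rintro rfl
    have : powSpan E β (0 : L) r₁ = ⊥ := by
      rw [eq_bot_iff]
      exact powSpan_le.mpr fun i _ => by simp
    rw [← hsup₁, this, finrank_bot] at hdim₁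
    omega
  have hτ : Module.finrank K S ≤ Module.finrank E E⟮β⟯ := by
    have hle : S ≤ mulField (E⟮β⟯.restrictScalars K) b₂ := by
      rw [← restrictScalars_mulField]
      have h1 := powSpan_le_mulField (K := E) β b₂ (r₁ + 1)
      rw [hsup₂] at h1
      exact fun x hx => h1 (hSZ.le hx)
    have := two_mul_finrank_le_of_le_mulField hS (by omega) hle
    rw [two_mul_finrank_adjoin, hE] at this
    omega
  obtain ⟨y, c, hc, hy, hyW, hyZ⟩ := exists_common_powSpan hr₁ hr₂τ hb₁
    (by rw [hsup₁, hsup₂]; exact hWZ)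
  exact ⟨y, c, r₁, hc, hr₁, by omega, by rwa [hy], hyW ▸ hsup₁, hyZ ▸ hsup₂⟩

/-- The situation left by `gap`: `W` and `Z` are consecutive `E`-subspaces for a quadratic field
`E`, `S` lies between them, and `β` keeps `E`-hyperplanes of `W` and of `Z`. -/
theorem exists_family_two {S W Z : Submodule K L} {E : IntermediateField K L}
    (hS : FullSpectrum S) (hE : Module.finrank K E = 2)
    (hEW : E ≤ stabilizer W) (hEZ : E ≤ stabilizer Z)
    (hdim : Module.finrank K Z = Module.finrank K W + 2)
    (hdimS : Module.finrank K S = Module.finrank K W + 1)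
    (hWS : W < S) (hSZ : S < Z) {β : L}
    (hWβ : Module.finrank K (slice W β) + 2 = Module.finrank K W)
    (hZβ : Module.finrank K (slice Z β) + 2 = Module.finrank K Z) :
    ∃ c ≠ 0, ∃ T : Submodule K L, T.map (LinearMap.mulLeft K c) = S ∧
      IsFamilyTwo (Module.finrank K S) T := by
  obtain ⟨y, c, l, hc, hl, hkl, hyτ, hsup₁, hsup₂⟩ :=
    exists_powSpan_of_slices hS hE hEW hEZ hdim hdimS hWS hSZ hWβ hZβ
  rw [powSpan_succ] at hsup₂
  obtain ⟨s, hs, hsW⟩ := Set.exists_of_ssubset hWS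
  obtain ⟨v, hv, t, ht, hvt⟩ : ∃ v ∈ powSpan E y c l, ∃ t ∈ Submodule.span E {y ^ l * c},
      v + t = s := by
    rw [← Submodule.mem_sup, hsup₂]
    exact hSZ.le hs
  obtain ⟨e, rfl⟩ := Submodule.mem_span_singleton.mp ht
  have hvW : v ∈ W := by rw [hsup₁] at hv; exact hv
  have htS : e • (y ^ l * c) ∈ S := by
    rw [← add_sub_cancel_left v (e • (y ^ l * c)), hvt]
    exact sub_mem hs (hWS.le hvW)
  have htW : e • (y ^ l * c) ∉ W := fun h => hsW (hvt ▸ add_mem hvW h)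
  have he : e ≠ 0 := by rintro rfl; exact htW (by rw [zero_smul]; exact zero_mem _)
  -- the leading coefficient `e` of a vector of `S` outside `W` is absorbed into the scalar `e c`
  have hSeq := eq_sup_span_singleton hWS.le htS htW hdimS.le
  have hc' : e • c ≠ 0 := smul_ne_zero he hc
  have hmap : ((powSpan E y 1 l).restrictScalars K).map (LinearMap.mulLeft K (e • c)) = W := by
    ext z
    have h1 : z ∈ W ↔ z ∈ powSpan E y (e • c) l := by
      rw [powSpan_smul he, hsup₁]; exact Iff.rfl
    rw [h1]
    simp only [Submodule.mem_map, LinearMap.mulLeft_apply, Submodule.restrictScalars_mem,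
      mem_powSpan, mul_one]
    constructor
    · rintro ⟨_, ⟨p, hp, rfl⟩, rfl⟩
      exact ⟨p, hp, mul_comm _ _⟩
    · rintro ⟨p, hp, rfl⟩
      exact ⟨_, ⟨p, hp, rfl⟩, mul_comm _ _⟩
  have hspan : Submodule.span E {z : L | ∃ i < l, z = y ^ i} = powSpan E y 1 l := by
    rw [powSpan_eq_span]
    simp only [mul_one]
  refine ⟨e • c, hc', (powSpan E y 1 l).restrictScalars K ⊔ Submodule.span K {y ^ l}, ?_, ?_, E,
    y, l, hE, ?_, by omega, ?_, ?_, ?_⟩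
  · rw [Submodule.map_sup, hmap, Submodule.map_span, Set.image_singleton, LinearMap.mulLeft_apply,
      smul_mul_assoc, mul_comm c]
    exact hSeq
  · rw [← Module.finrank_mul_finrank K E L, hE]
    exact even_two_mul _
  · intro hyE
    have : E⟮y⟯ = ⊥ := adjoin_simple_eq_bot_iff.mpr (mem_bot.mpr ⟨⟨y, hyE⟩, rfl⟩)
    rw [this, IntermediateField.finrank_bot] at hyτ
    omega
  · rw [lt_div_iff₀ two_pos]
    exact_mod_cast (by omega : l * 2 < Module.finrank E E⟮y⟯)
  · rw [hspan]
    refine disjoint_powSpan ?_ (by omega)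
    rintro rfl
    rw [adjoin_zero, IntermediateField.finrank_bot] at hyτ
    omega
  · rw [hspan]

/-- Up to a scalar factor, a space of full spectrum belongs to one of the two families. -/
theorem exists_family_of_fullSpectrum {S : Submodule K L} (hS : FullSpectrum S)
    (hnk : ¬ (Module.finrank K L = 1 ∧ Module.finrank K S = 0)) :
    ∃ c ≠ 0, ∃ T : Submodule K L, T.map (LinearMap.mulLeft K c) = S ∧
      (IsFamilyOne (Module.finrank K S) T ∨ IsFamilyTwo (Module.finrank K S) T) := by
  have hpos : 0 < Module.finrank K L := Module.finrank_pos
  have h2n : 2 * Module.finrank K S ≤ Module.finrank K L := by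
    rcases Nat.eq_zero_or_pos (Module.finrank K S) with h0 | h0
    · omega
    obtain ⟨γ, hγ⟩ := hS 0 h0
    have := two_mul_finrank_le_slice (S := S) (γ := γ) le_top (fun _ _ => Submodule.mem_top)
    rwa [hγ, finrank_top, zero_add] at this
  rcases Nat.lt_or_ge 1 (Module.finrank K S) with hk | hk
  · obtain ⟨α, hα⟩ := hS (Module.finrank K S - 1) (by omega)
    obtain ⟨W, hW, hWα, -, b, r, hr, hrτ, hsup, hdim⟩ := exists_pencil (α := α) (S := S) (by omega)
    have hbW : b ∉ W := by
      intro hmem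
      have : powSpan K α b r ≤ W :=
        powSpan_le.mpr fun i _ => (pow_mem hWα i : α ^ i ∈ stabilizer W) _ hmem
      rw [sup_eq_left.mpr this] at hsup
      rw [hsup] at hdim
      omega
    have hst := adjoin_le_stabilizer hWα
    rcases Nat.eq_zero_or_pos (Module.finrank K W) with h0 | h0
    · obtain rfl : W = ⊥ := Submodule.finrank_eq_zero.mp h0
      rw [bot_sup_eq] at hsup
      obtain rfl : Module.finrank K S = r := by omega
      obtain ⟨c, hc, T, hT, hT'⟩ := exists_family_one (S := S) (x := α) (b := b)
        (k := Module.finrank K S)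
        (fun h => hbW (by rw [h]; exact zero_mem _)) (by
          rintro ⟨a, rfl⟩
          have : K⟮algebraMap K L a⟯ = ⊥ := adjoin_simple_eq_bot_iff.mpr
            (IntermediateField.algebraMap_mem _ a)
          rw [this, IntermediateField.finrank_bot] at hrτ
          omega)
        (two_mul_finrank_le_of_le_mulField hS hk
          (hsup.ge.trans (powSpan_le_mulField α b _))) h2n hsup.symm
      exact ⟨c, hc, T, hT, Or.inl hT'⟩
    · have hZdim := finrank_sup_mulField hst hbW
      have hWS : W < S := lt_of_le_of_ne hW fun h => by rw [h] at hdim; omega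
      have hSZ : S < W ⊔ mulField K⟮α⟯ b := by
        refine lt_of_le_of_ne (hsup ▸ sup_le_sup_left (powSpan_le_mulField α b r) W) fun h => ?_
        rw [h] at hdim
        omega
      have hstZ := le_stabilizer_sup hst (le_stabilizer_mulField K⟮α⟯ b)
      obtain ⟨hE, hdimS, β, -, hWβ, hZβ⟩ := gap hS h0 hst hstZ hZdim hWS hSZ
      obtain ⟨c, hc, T, hT, hT'⟩ := exists_family_two hS hE hst hstZ (hE ▸ hZdim) hdimS hWS hSZ
        hWβ hZβ
      exact ⟨c, hc, T, hT, Or.inr hT'⟩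
  -- in dimension at most one, any `x` outside `K` will do
  · obtain ⟨x, hx⟩ : ∃ x : L, x ∉ Set.range (algebraMap K L) := by
      by_contra! hcon
      have h1 : (⊥ : IntermediateField K L) = ⊤ :=
        eq_top_iff.mpr fun x _ => mem_bot.mpr (hcon x)
      have h2 : Module.finrank K (⊥ : IntermediateField K L) = Module.finrank K L := by
        rw [h1, IntermediateField.finrank_top']
      rw [IntermediateField.finrank_bot] at h2
      omega
    have hxpos : 0 < Module.finrank K K⟮x⟯ := Module.finrank_pos
    have : ∃ b : L, b ≠ 0 ∧ S = powSpan K x b (Module.finrank K S) := by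
      rcases Nat.eq_zero_or_pos (Module.finrank K S) with h0 | h0
      · refine ⟨1, one_ne_zero, ?_⟩
        rw [h0, Submodule.finrank_eq_zero.mp h0, eq_comm, eq_bot_iff]
        exact powSpan_le.mpr fun i hi => absurd hi (Nat.not_lt_zero _)
      · have h1 : Module.finrank K S = 1 := by omega
        obtain ⟨b, hb, hb0⟩ := Submodule.exists_mem_ne_zero_of_ne_bot
          (fun h : S = ⊥ => by rw [h, finrank_bot] at h0; omega)
        refine ⟨b, hb0, (Submodule.eq_of_le_of_finrank_le (powSpan_le.mpr fun i hi => ?_)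
          (by rw [finrank_powSpan hb0 (by omega)])).symm⟩
        obtain rfl : i = 0 := by omega
        simpa using hb
    obtain ⟨b, hb, hSb⟩ := this
    obtain ⟨c, hc, T, hT, hT'⟩ := exists_family_one hb hx (by omega) h2n hSb
    exact ⟨c, hc, T, hT, Or.inl hT'⟩

end Descent

/-! ### The two families have full spectrum -/

section Attained

open Polynomial IntermediateField

variable {K L : Type*} [Field K] [Field L] [Algebra K L]

/-- The space `⟨1, x, …, x ^ (l - 1)⟩_E + x ^ l K` of the second family: the values at `x` of the
polynomials over `E` of degree at most `l` whose coefficient at `X ^ l` is in `K`. -/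
noncomputable def powSpanTop (E : IntermediateField K L) (x : L) (l : ℕ) : Submodule K L :=
  (powSpan E x 1 l).restrictScalars K ⊔ Submodule.span K {x ^ l}

theorem mem_powSpanTop {E : IntermediateField K L} {x y : L} {l : ℕ} :
    y ∈ powSpanTop E x l ↔ ∃ p : E[X], p.natDegree ≤ l ∧
      p.coeff l ∈ Set.range (algebraMap K E) ∧ aeval x p = y := by
  constructor
  · intro hy
    obtain ⟨v, hv, t, ht, rfl⟩ := Submodule.mem_sup.mp hy
    obtain ⟨a, rfl⟩ := Submodule.mem_span_singleton.mp ht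
    obtain ⟨p, hp, rfl⟩ := mem_powSpan.mp ((Submodule.restrictScalars_mem K _ v).mp hv)
    refine ⟨p + monomial l (algebraMap K E a), ?_, ⟨a, ?_⟩, ?_⟩
    · exact (natDegree_add_le _ _).trans (max_le (natDegree_le_of_degree_le hp.le)
        (natDegree_monomial_le _))
    · rw [coeff_add, coeff_monomial_same, coeff_eq_zero_of_degree_lt hp, zero_add]
    · rw [map_add, aeval_monomial, mul_one, ← IsScalarTower.algebraMap_apply, Algebra.smul_def]
  · rintro ⟨p, hp, ⟨a, ha⟩, rfl⟩
    refine Submodule.mem_sup.mpr ⟨aeval x (p - monomial l (p.coeff l)), ?_, a • x ^ l,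
      Submodule.mem_span_singleton.mpr ⟨a, rfl⟩, ?_⟩
    · refine mem_powSpan.mpr ⟨p - monomial l (p.coeff l), ?_, mul_one _⟩
      rw [degree_lt_iff_coeff_zero]
      intro j hj
      rw [coeff_sub, coeff_monomial]
      rcases hj.eq_or_lt with rfl | hlt
      · simp
      · rw [if_neg hlt.ne, coeff_eq_zero_of_natDegree_lt (hp.trans_lt hlt), sub_zero]
    · rw [map_sub, aeval_monomial, ← ha, ← IsScalarTower.algebraMap_apply, Algebra.smul_def,
        sub_add_cancel]

variable [FiniteDimensional K L]

theorem slice_powSpan {x : L} {i d : ℕ} (h : 2 * i + d ≤ Module.finrank K K⟮x⟯) :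
    slice (powSpan K x 1 (i + d)) (x ^ i) = powSpan K x 1 d := by
  refine le_antisymm (fun y hy => ?_) (powSpan_le.mpr fun j hj => ⟨?_, ?_⟩)
  · obtain ⟨p, hp, rfl⟩ := mem_powSpan.mp hy.1
    obtain ⟨q, hq, hqp⟩ := mem_powSpan.mp hy.2
    refine mem_powSpan.mpr ⟨p, ?_, rfl⟩
    rcases eq_or_ne p 0 with rfl | hp0
    · rw [degree_zero]; exact WithBot.bot_lt_coe d
    have h0 : X ^ i * p ≠ 0 := mul_ne_zero (pow_ne_zero _ X_ne_zero) hp0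
    rw [degree_eq_natDegree hp0] at hp
    have hp' : p.natDegree < i + d := by exact_mod_cast hp
    have heq : X ^ i * p = q := by
      refine eq_of_aeval_eq (x := x) ?_ (hq.trans_le (by exact_mod_cast (by omega))) ?_
      · rw [degree_eq_natDegree h0, natDegree_X_pow_mul _ hp0]
        exact_mod_cast (by omega : p.natDegree + i < Module.finrank K K⟮x⟯)
      · simpa using hqp.symm
    rw [← heq, degree_eq_natDegree h0, natDegree_X_pow_mul _ hp0] at hq
    have hq' : p.natDegree + i < i + d := by exact_mod_cast hq
    rw [degree_eq_natDegree hp0]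
    exact_mod_cast (by omega : p.natDegree < d)
  · exact pow_mul_mem_powSpan (by omega)
  · change x ^ i * (x ^ j * 1) ∈ powSpan K x 1 (i + d)
    rw [← mul_assoc, ← pow_add]
    exact pow_mul_mem_powSpan (by omega)

theorem IsFamilyOne.fullSpectrum {k : ℕ} {S : Submodule K L} (h : IsFamilyOne k S) :
    FullSpectrum S := by
  obtain ⟨x, hx, h1, h2, rfl⟩ := h
  have hspan : Submodule.span K {y : L | ∃ i < k, y = x ^ i} = powSpan K x 1 k := by
    rw [powSpan_eq_span]
    simp only [mul_one]
  rw [hspan]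
  have hpos : 0 < Module.finrank K K⟮x⟯ := Module.finrank_pos
  have hle : Module.finrank K K⟮x⟯ ≤ Module.finrank K L :=
    Submodule.finrank_le K⟮x⟯.toSubalgebra.toSubmodule
  have h1' : Module.finrank K K⟮x⟯ < Module.finrank K L → 2 * k ≤ Module.finrank K K⟮x⟯ + 1 := by
    intro h
    have := h1 h
    rw [le_div_iff₀ two_pos, mul_comm] at this
    exact_mod_cast this
  have h2' : Module.finrank K K⟮x⟯ = Module.finrank K L → 2 * k ≤ Module.finrank K L := by
    intro h
    have := h2 h
    rw [le_div_iff₀ two_pos, mul_comm] at this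
    exact_mod_cast this
  have hkm : k ≤ Module.finrank K K⟮x⟯ := by omega
  intro d hd
  rw [finrank_powSpan one_ne_zero hkm] at hd
  by_cases hcase : d = 0 ∧ Module.finrank K K⟮x⟯ < Module.finrank K L
  · obtain ⟨rfl, hlt⟩ := hcase
    obtain ⟨γ, hγ⟩ : ∃ γ : L, γ ∉ K⟮x⟯ := by
      by_contra! hcon
      have : K⟮x⟯ = ⊤ := eq_top_iff.mpr fun y _ => hcon y
      rw [this, IntermediateField.finrank_top'] at hlt
      exact lt_irrefl _ hlt
    exact ⟨γ, by rw [slice_eq_bot (powSpan_le_mulField x 1 k) hγ, finrank_bot]⟩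
  · obtain ⟨i, rfl⟩ : ∃ i, k = i + d := ⟨k - d, by omega⟩
    refine ⟨x ^ i, ?_⟩
    rw [slice_powSpan (by omega), finrank_powSpan one_ne_zero (by omega)]

theorem finrank_powSpanTop {E : IntermediateField K L} {x : L} {l : ℕ} (hx : x ≠ 0)
    (hdisj : Disjoint ((powSpan E x 1 l).restrictScalars K) (Submodule.span K {x ^ l}))
    (hl : l ≤ Module.finrank E E⟮x⟯) :
    Module.finrank K (powSpanTop E x l) = Module.finrank K E * l + 1 := by
  have := Submodule.finrank_sup_add_finrank_inf_eq ((powSpan E x 1 l).restrictScalars K)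
    (Submodule.span K {x ^ l})
  rw [disjoint_iff.mp hdisj, finrank_bot, add_zero, finrank_span_singleton (pow_ne_zero l hx),
    finrank_restrictScalars, finrank_powSpan one_ne_zero hl] at this
  exact this

theorem eq_of_aeval_eq_of_natDegree {x : L} {p q : K[X]}
    (hp : p.natDegree < Module.finrank K K⟮x⟯) (hq : q.natDegree < Module.finrank K K⟮x⟯)
    (h : aeval x p = aeval x q) : p = q :=
  eq_of_aeval_eq (degree_le_natDegree.trans_lt (by exact_mod_cast hp))
    (degree_le_natDegree.trans_lt (by exact_mod_cast hq)) h

theorem slice_powSpanTop {E : IntermediateField K L} {x : L} {i j : ℕ} (hi : 1 ≤ i)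
    (h : 2 * i + j < Module.finrank E E⟮x⟯) :
    slice (powSpanTop E x (i + j)) (x ^ i) = powSpanTop E x j := by
  ext y
  rw [mem_slice, mem_powSpanTop, mem_powSpanTop, mem_powSpanTop]
  constructor
  · rintro ⟨⟨p, hp, -, rfl⟩, q, hq, hqK, hqp⟩
    have heq : X ^ i * p = q := by
      refine eq_of_aeval_eq_of_natDegree (x := x) ?_ (by omega) (by simp [hqp])
      have := natDegree_mul_le (p := X ^ i) (q := p)
      rw [natDegree_X_pow] at this
      omega
    refine ⟨p, ?_, ?_, rfl⟩
    · rcases eq_or_ne p 0 with rfl | hp0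
      · simp
      rw [← heq, natDegree_X_pow_mul _ hp0] at hq
      omega
    · rwa [← heq, add_comm i j, coeff_X_pow_mul] at hqK
  · rintro ⟨p, hp, hpK, rfl⟩
    refine ⟨⟨p, by omega, ⟨0, ?_⟩, rfl⟩, X ^ i * p, ?_, ?_, by simp⟩
    · rw [map_zero, coeff_eq_zero_of_natDegree_lt (by omega)]
    · refine natDegree_mul_le.trans ?_
      rw [natDegree_X_pow]
      omega
    · rwa [add_comm i j, coeff_X_pow_mul]

/-- The even dimensions in the second family. A pair `f, g` with `e x ^ i f(x) = r(x) g(x)`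
satisfies `e X ^ i f = r g`, so that `f = r h` and `g = e X ^ i h` by coprimality; both top
coefficients lie in `K`, they differ by the factor `e ∉ K`, and so both vanish. -/
theorem slice_powSpanTop_div {E : IntermediateField K L} {x : L} {i j : ℕ} {r : E[X]}
    (hr : r.Monic) (hri : r.natDegree = i) (hco : IsCoprime (X ^ i) r) {e : E}
    (he : e ∉ Set.range (algebraMap K E))
    (h : 2 * i + j < Module.finrank E E⟮x⟯) :
    slice (powSpanTop E x (i + j)) (e * x ^ i / aeval x r) =
      (powSpan E x (aeval x r) j).restrictScalars K := by
  have he0 : e ≠ 0 := fun h => he ⟨0, by rw [h, map_zero]⟩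
  have hrx : aeval x r ≠ 0 := fun h0 =>
    hr.ne_zero (eq_of_aeval_eq_of_natDegree (x := x) (by omega) (by simp; omega)
      (by simpa using h0))
  ext y
  rw [mem_slice, mem_powSpanTop, mem_powSpanTop, Submodule.restrictScalars_mem, mem_powSpan]
  constructor
  · rintro ⟨⟨f, hf, hfK, rfl⟩, g, hg, hgK, hgf⟩
    have heq : C e * X ^ i * f = r * g := by
      refine eq_of_aeval_eq_of_natDegree (x := x) ?_ ?_ ?_
      · have h1 := natDegree_mul_le (p := C e * X ^ i) (q := f)
        have h2 := natDegree_C_mul_X_pow_le e i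
        omega
      · have h1 := natDegree_mul_le (p := r) (q := g)
        omega
      · simp only [map_mul, map_pow, aeval_C, aeval_X, hgf]
        rw [show algebraMap E L e = (e : L) from rfl]
        field_simp
    obtain ⟨t, rfl⟩ : X ^ i ∣ g := hco.dvd_of_dvd_mul_left ⟨C e * f, by rw [← heq]; ring⟩
    have hf' : f = r * (C e⁻¹ * t) := by
      have h1 : X ^ i * (C e * f) = X ^ i * (r * t) := by
        rw [← mul_assoc, mul_comm (X ^ i) (C e), heq]; ring
      have h2 := mul_left_cancel₀ (pow_ne_zero i X_ne_zero) h1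
      rw [mul_left_comm, ← h2, ← mul_assoc, ← C_mul, inv_mul_cancel₀ he0, C_1, one_mul]
    have ht : t.natDegree ≤ j := by
      rcases eq_or_ne t 0 with rfl | ht0
      · simp
      rw [natDegree_X_pow_mul _ ht0] at hg
      omega
    have hs : (C e⁻¹ * t).natDegree ≤ j := (natDegree_C_mul_le _ _).trans ht
    have hcoeff : (C e⁻¹ * t).coeff j = 0 := by
      have h1 : f.coeff (i + j) = e⁻¹ * t.coeff j := by
        rw [hf', coeff_mul_add_eq_of_natDegree_le hri.le hs, ← hri, hr.coeff_natDegree, one_mul,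
          coeff_C_mul]
      rw [add_comm i j, coeff_X_pow_mul] at hgK
      rw [h1] at hfK
      obtain ⟨a, ha⟩ := hfK
      obtain ⟨b, hb⟩ := hgK
      rw [coeff_C_mul, ← ha]
      by_contra hne
      have hb0 : algebraMap K E b = e * algebraMap K E a := by
        rw [hb, ha, mul_inv_cancel_left₀ he0]
      exact he ⟨b / a, by rw [map_div₀, hb0, mul_div_cancel_right₀ _ hne]⟩
    refine ⟨C e⁻¹ * t, ?_, ?_⟩
    · rw [degree_lt_iff_coeff_zero]
      intro m hm
      rcases hm.eq_or_lt with rfl | hlt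
      · exact hcoeff
      · exact coeff_eq_zero_of_natDegree_lt (hs.trans_lt hlt)
    · rw [hf', mul_comm r, map_mul (aeval x) (C e⁻¹ * t) r]
  · rintro ⟨p, hp, rfl⟩
    have hp' : p.natDegree ≤ j := natDegree_le_of_degree_le hp.le
    have hpj : p.coeff j = 0 := coeff_eq_zero_of_degree_lt hp
    refine ⟨⟨r * p, ?_, ⟨0, ?_⟩, ?_⟩, C e * X ^ i * p, ?_, ⟨0, ?_⟩, ?_⟩
    · have := natDegree_mul_le (p := r) (q := p)
      omega
    · rw [map_zero, coeff_mul_add_eq_of_natDegree_le hri.le hp', hpj, mul_zero]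
    · rw [map_mul, mul_comm]
    · have h1 := natDegree_mul_le (p := C e * X ^ i) (q := p)
      have h2 := natDegree_C_mul_X_pow_le e i
      omega
    · rw [map_zero, mul_assoc, coeff_C_mul, add_comm i j, coeff_X_pow_mul, hpj, mul_zero]
    · simp only [map_mul, map_pow, aeval_C, aeval_X]
      rw [show algebraMap E L e = (e : L) from rfl]
      field_simp

theorem IsFamilyTwo.fullSpectrum {k : ℕ} {S : Submodule K L} (h : IsFamilyTwo k S) :
    FullSpectrum S := by
  obtain ⟨-, E, x, l, hE, hx, -, hl, -, rfl⟩ := h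
  have hspan : Submodule.span E {y : L | ∃ i < l, y = x ^ i} = powSpan E x 1 l := by
    rw [powSpan_eq_span]
    simp only [mul_one]
  rw [hspan]
  change FullSpectrum (powSpanTop E x l)
  rw [lt_div_iff₀ two_pos] at hl
  have hl' : l * 2 < Module.finrank E E⟮x⟯ := by exact_mod_cast hl
  have hx0 : x ≠ 0 := by rintro rfl; exact hx (zero_mem _)
  have hdim : ∀ j ≤ l, Module.finrank K (powSpanTop E x j) = 2 * j + 1 := fun j hj => by
    rw [finrank_powSpanTop hx0 (disjoint_powSpan hx0 (by omega)) (by omega), hE]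
  obtain ⟨e, he⟩ : ∃ e : E, e ∉ Set.range (algebraMap K E) := by
    by_contra! hcon
    have h1 : Module.finrank K E = 1 := by
      rw [← (AlgEquiv.ofBijective (Algebra.ofId K E)
        ⟨(algebraMap K E).injective, hcon⟩).toLinearEquiv.finrank_eq, Module.finrank_self]
    omega
  intro d hd
  rw [hdim l le_rfl] at hd
  rcases Nat.even_or_odd' d with ⟨j, rfl | rfl⟩
  · obtain ⟨i, rfl⟩ : ∃ i, l = i + j := ⟨l - j, by omega⟩
    -- `X ^ 0 + 1` is not monic
    obtain ⟨r, hr, hri, hco⟩ : ∃ r : E[X], r.Monic ∧ r.natDegree = i ∧ IsCoprime (X ^ i) r := by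
      rcases Nat.eq_zero_or_pos i with rfl | hi
      · exact ⟨1, monic_one, natDegree_one, isCoprime_one_right⟩
      · exact ⟨X ^ i + C 1, monic_X_pow_add_C 1 hi.ne', natDegree_X_pow_add_C, -1, 1, by simp⟩
    have hrx : aeval x r ≠ 0 := fun h0 => hr.ne_zero
      (eq_of_aeval_eq_of_natDegree (x := x) (by omega) (by simp; omega) (by simpa using h0))
    refine ⟨e * x ^ i / aeval x r, ?_⟩
    rw [slice_powSpanTop_div hr hri hco he (by omega), finrank_restrictScalars, hE,
      finrank_powSpan hrx (by omega)]
  · obtain ⟨i, rfl⟩ : ∃ i, l = i + j := ⟨l - j, by omega⟩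
    refine ⟨x ^ i, ?_⟩
    rw [slice_powSpanTop (by omega) (by omega), hdim j (by omega)]

end Attained

/-! ### Singer subgroups and the field they generate -/

section Singer

open Polynomial

variable {K L : Type*} [Field K] [Field L] [Algebra K L]

/-- A finite commutative algebra with inverses is a field, hence determined by its dimension. It is
stated without a `Field` instance on `A`, as it is applied to an algebra of matrices. -/
theorem nonempty_algEquiv_of_inverses {A : Type*} [Finite K] [FiniteDimensional K L]
    [Ring A] [Nontrivial A] [Algebra K A]
    [FiniteDimensional K A] (hcomm : ∀ a b : A, a * b = b * a)
    (hinv : ∀ a : A, a ≠ 0 → ∃ b, a * b = 1)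
    (hdim : Module.finrank K A = Module.finrank K L) : Nonempty (A ≃ₐ[K] L) := by
  let : Field A := IsField.toField ⟨exists_pair_ne A, hcomm, fun {a} ha => hinv a ha⟩
  have : Finite L := Module.finite_of_finite K
  have : Finite A := Module.finite_of_finite K
  obtain ⟨f⟩ := FiniteField.nonempty_algHom_of_finrank_dvd (F := K) (K := A) (L := L) hdim.dvd
  exact ⟨AlgEquiv.ofBijective f ⟨f.injective,
    (LinearMap.injective_iff_surjective_of_finrank_eq_finrank (f := f.toLinearMap) hdim).mp
      f.injective⟩⟩

/-- By Cayley-Hamilton. -/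
theorem finrank_adjoin_matrix_le {n : ℕ} (g : Matrix (Fin n) (Fin n) K) :
    Module.finrank K (Algebra.adjoin K {g}) ≤ n := by
  have hle : Subalgebra.toSubmodule (Algebra.adjoin K {g}) ≤
      (degreeLT K n).map (aeval g).toLinearMap := by
    intro a ha
    rw [Subalgebra.mem_toSubmodule, Algebra.adjoin_singleton_eq_range_aeval] at ha
    obtain ⟨p, rfl⟩ := ha
    refine ⟨p %ₘ g.charpoly, ?_, ?_⟩
    · rw [SetLike.mem_coe, mem_degreeLT]
      refine (degree_modByMonic_lt _ g.charpoly_monic).trans_le ?_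
      rw [Matrix.charpoly_degree_eq_dim, Fintype.card_fin]
    · exact aeval_modByMonic_eq_self_of_root (Matrix.aeval_self_charpoly g)
  have h1 := Submodule.finrank_mono hle
  have h2 := Submodule.finrank_map_le (aeval g).toLinearMap (degreeLT K n)
  rw [(degreeLTEquiv K n).finrank_eq, Module.finrank_fin_fun] at h2
  exact h1.trans h2

/-- A Singer subgroup acts on `K ^ n`, suitably identified with `L`, as the multiplicative group of
`L`. A generator `g` has `q ^ n - 1` distinct powers in `K[g]`, which has at most `q ^ n` elements;
so `K[g]` is the union of `0` and the Singer subgroup, a field isomorphic to `L`, and `K ^ n` is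
one-dimensional over it. -/
theorem exists_linearEquiv_of_isSingerSubgroup [Finite K] [FiniteDimensional K L] {n : ℕ}
    (hn : Module.finrank K L = n) {H : Subgroup (Matrix.GeneralLinearGroup (Fin n) K)}
    (hH : IsSingerSubgroup H) :
    ∃ e : (Fin n → K) ≃ₗ[K] L,
      (∀ h ∈ H, ∃ γ : L, γ ≠ 0 ∧ ∀ v, e ((h : Matrix (Fin n) (Fin n) K).mulVec v) = γ * e v) ∧
      ∀ γ : L, γ ≠ 0 → ∃ h ∈ H, ∀ v,
        e ((h : Matrix (Fin n) (Fin n) K).mulVec v) = γ * e v := by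
  classical
  obtain ⟨hcyc, hcard⟩ := hH
  have hn0 : 0 < n := hn ▸ Module.finrank_pos
  have : Nonempty (Fin n) := ⟨⟨0, hn0⟩⟩
  have : Finite (Matrix.GeneralLinearGroup (Fin n) K) := by
    have : Finite (Matrix (Fin n) (Fin n) K) := Module.finite_of_finite K
    exact Finite.of_injective (fun g : Matrix.GeneralLinearGroup (Fin n) K =>
      (g : Matrix (Fin n) (Fin n) K)) Units.val_injective
  obtain ⟨g, hg⟩ := IsCyclic.exists_monoid_generator (α := H)
  set A := Algebra.adjoin K {((g : Matrix.GeneralLinearGroup (Fin n) K) :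
    Matrix (Fin n) (Fin n) K)} with hA
  have : Finite A := Module.finite_of_finite K
  have hmem : ∀ h : H, ((h : Matrix.GeneralLinearGroup (Fin n) K) :
      Matrix (Fin n) (Fin n) K) ∈ A := by
    intro h
    obtain ⟨i, rfl⟩ := hg h
    simpa using pow_mem (Algebra.subset_adjoin (Set.mem_singleton _)) i
  -- zero together with the Singer subgroup
  let f : Option H → A := fun o => o.elim 0 fun h => ⟨_, hmem h⟩
  have hf : Function.Injective f := by
    rintro (_ | h) (_ | h') hh
    · rfl
    · exact absurd (congrArg Subtype.val hh).symm (Units.ne_zero h'.1)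
    · exact absurd (congrArg Subtype.val hh) (Units.ne_zero h.1)
    · exact congrArg some (Subtype.ext (Units.ext (congrArg Subtype.val hh)))
  have hq : 1 < Nat.card K := Finite.one_lt_card
  have hcardA : Nat.card A = Nat.card K ^ Module.finrank K A := Module.natCard_eq_pow_finrank
  have hcardO : Nat.card (Option H) = Nat.card K ^ n := by
    rw [Finite.card_option, hcard]
    exact Nat.sub_add_cancel (Nat.one_le_pow _ _ (by omega))
  have hle : Nat.card A ≤ Nat.card (Option H) := by
    rw [hcardA, hcardO]
    exact Nat.pow_le_pow_right (by omega) (finrank_adjoin_matrix_le _)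
  have hbij := hf.bijective_of_nat_card_le hle
  have hdim : Module.finrank K A = n := by
    have h1 := Nat.card_eq_of_bijective f hbij
    rw [hcardA, hcardO] at h1
    exact (Nat.pow_right_injective hq h1).symm
  -- every nonzero element of `A` lies in the Singer subgroup
  have hsurj : ∀ a : A, a ≠ 0 → ∃ h : H, ((h : Matrix.GeneralLinearGroup (Fin n) K) :
      Matrix (Fin n) (Fin n) K) = a := by
    intro a ha
    obtain ⟨o, rfl⟩ := hbij.2 a
    rcases o with _ | h
    · exact absurd rfl ha
    · exact ⟨h, rfl⟩
  have hinv : ∀ a : A, a ≠ 0 → ∃ b, a * b = 1 := by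
    intro a ha
    obtain ⟨h, hh⟩ := hsurj a ha
    refine ⟨⟨_, hmem h⁻¹⟩, Subtype.ext ?_⟩
    change (a : Matrix (Fin n) (Fin n) K) * _ = 1
    rw [← hh, ← Units.val_mul]
    simp
  have hcomm : ∀ a b : A, a * b = b * a := fun a b =>
    (Algebra.isMulCommutative_adjoin K (s := {((g : Matrix.GeneralLinearGroup (Fin n) K) :
      Matrix (Fin n) (Fin n) K)}) (by simp)).is_comm.comm a b
  obtain ⟨σ⟩ := nonempty_algEquiv_of_inverses (L := L) hcomm hinv (hdim.trans hn.symm)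
  obtain ⟨v₀, hv₀⟩ := exists_ne (0 : Fin n → K)
  let φ : A →ₗ[K] (Fin n → K) :=
    { toFun := fun a => (a : Matrix (Fin n) (Fin n) K).mulVec v₀
      map_add' := fun a b => Matrix.add_mulVec _ _ _
      map_smul' := fun c a => Matrix.smul_mulVec _ _ _ }
  have hφ : Function.Injective φ := by
    rw [← LinearMap.ker_eq_bot, eq_bot_iff]
    intro a ha
    by_contra hne
    obtain ⟨b, hb⟩ := hinv a hne
    refine hv₀ ?_
    have h1 : (b : Matrix (Fin n) (Fin n) K) * a = 1 := by
      have := congrArg Subtype.val ((hcomm b a).trans hb)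
      exact this
    have h2 : (a : Matrix (Fin n) (Fin n) K).mulVec v₀ = 0 := ha
    rw [← Matrix.one_mulVec v₀, ← h1, ← Matrix.mulVec_mulVec, h2, Matrix.mulVec_zero]
  let ψ : A ≃ₗ[K] (Fin n → K) := LinearEquiv.ofInjectiveOfFinrankEq φ hφ
    (by rw [hdim, Module.finrank_fin_fun])
  have hψ : ∀ (a : A) v, ψ.symm ((a : Matrix (Fin n) (Fin n) K).mulVec v) = a * ψ.symm v := by
    intro a v
    obtain ⟨b, rfl⟩ := ψ.surjective v
    rw [LinearEquiv.symm_apply_eq, LinearEquiv.symm_apply_apply]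
    change (a : Matrix (Fin n) (Fin n) K).mulVec ((b : Matrix (Fin n) (Fin n) K).mulVec v₀) =
      ((a * b : A) : Matrix (Fin n) (Fin n) K).mulVec v₀
    rw [Matrix.mulVec_mulVec]
    rfl
  refine ⟨ψ.symm.trans σ.toLinearEquiv, fun h hh => ⟨σ ⟨_, hmem ⟨h, hh⟩⟩, ?_, fun v => ?_⟩,
    fun γ hγ => ?_⟩
  · rw [Ne, EmbeddingLike.map_eq_zero_iff]
    exact fun h0 => Units.ne_zero h (congrArg Subtype.val h0)
  · have := congrArg σ (hψ ⟨_, hmem ⟨h, hh⟩⟩ v)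
    rwa [map_mul] at this
  · obtain ⟨⟨h, hh⟩, hha⟩ := hsurj (σ.symm γ) (by rwa [Ne, EmbeddingLike.map_eq_zero_iff])
    refine ⟨h, hh, fun v => ?_⟩
    have := congrArg σ (hψ (σ.symm γ) v)
    rw [map_mul, AlgEquiv.apply_symm_apply, ← hha] at this
    exact this

end Singer

/-! ### From projective subspaces to subspaces of the field -/

section Transport

variable {K L : Type*} [Field K] [Field L] [Algebra K L] {n : ℕ}

theorem mem_submodule_image (g : Matrix.GeneralLinearGroup (Fin n) K)
    (Λ : Projectivization.Subspace K (Fin n → K)) (v : Fin n → K) :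
    v ∈ (image (.mk g) Λ).submodule ↔ g⁻¹ • v ∈ Λ.submodule := by
  rcases eq_or_ne v 0 with rfl | hv
  · rw [smul_zero]
    exact iff_of_true (zero_mem _) (zero_mem _)
  · rw [Projectivization.Subspace.mem_submodule_iff _ hv,
      Projectivization.Subspace.mem_submodule_iff _ ((smul_ne_zero_iff_ne g⁻¹).mpr hv)]
    change (Matrix.ProjGenLinGroup.mk g)⁻¹ • Projectivization.mk K v hv ∈ Λ ↔ _
    rw [← map_inv, Projectivization.PGL.mk_smul_mk]

theorem image_eq_definedBy_iff (B : Module.Basis (Fin n) K L)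
    {g : Matrix.GeneralLinearGroup (Fin n) K} {e : (Fin n → K) ≃ₗ[K] L}
    (hge : ∀ v, g • v = B.equivFun (e v)) (Λ : Projectivization.Subspace K (Fin n → K))
    (S : Submodule K L) :
    image (.mk g) Λ = definedBy B S ↔ ∀ v, v ∈ Λ.submodule ↔ e v ∈ S := by
  have key : ∀ v, g • v ∈ (image (.mk g) Λ).submodule ↔ v ∈ Λ.submodule := fun v => by
    rw [mem_submodule_image, inv_smul_smul]
  have key' : ∀ v, g • v ∈ (definedBy B S).submodule ↔ e v ∈ S := fun v => by
    rw [definedBy, OrderIso.apply_symm_apply, hge, Submodule.mem_map_equiv,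
      LinearEquiv.symm_apply_apply]
  constructor
  · intro h v
    rw [← key, h, key']
  · intro h
    apply Projectivization.Subspace.submodule.injective
    ext v
    rw [← smul_inv_smul g v, key, key', h]

/-- Under the identification `e` of `K ^ n` with `L`, the group `G` of projectivities is the one
induced by the multiplications by nonzero elements of `L`. -/
def IsInducedByMultiplications (e : (Fin n → K) ≃ₗ[K] L)
    (G : Subgroup (Matrix.ProjGenLinGroup (Fin n) K)) : Prop :=
  ∀ φ, φ ∈ G ↔ ∃ (u : Lˣ) (h : Matrix.GeneralLinearGroup (Fin n) K),
    .mk h = φ ∧ ∀ v, e (h • v) = u * e v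

theorem IsInducedByMultiplications.smul {e e' : (Fin n → K) ≃ₗ[K] L}
    {G : Subgroup (Matrix.ProjGenLinGroup (Fin n) K)} (h : IsInducedByMultiplications e G)
    {c : L} (hc : c ≠ 0) (he : ∀ v, e v = c * e' v) : IsInducedByMultiplications e' G := by
  intro φ
  rw [h φ]
  refine exists₂_congr fun u h => and_congr_right fun _ => forall_congr' fun v => ?_
  rw [he, he, mul_left_comm, mul_right_inj' hc]

theorem IsSingerCycle.exists_isInducedByMultiplications [Finite K] [FiniteDimensional K L]
    (hn : Module.finrank K L = n) {G : Subgroup (Matrix.ProjGenLinGroup (Fin n) K)}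
    (hG : IsSingerCycle G) : ∃ e : (Fin n → K) ≃ₗ[K] L, IsInducedByMultiplications e G := by
  obtain ⟨H, hH, rfl⟩ := hG
  obtain ⟨e, h1, h2⟩ := exists_linearEquiv_of_isSingerSubgroup hn hH
  refine ⟨e, fun φ => ?_⟩
  rw [Subgroup.mem_map]
  constructor
  · rintro ⟨h, hh, rfl⟩
    obtain ⟨γ, hγ, hv⟩ := h1 h hh
    exact ⟨Units.mk0 γ hγ, h, rfl, hv⟩
  · rintro ⟨u, h, rfl, hv⟩
    obtain ⟨h', hh', hv'⟩ := h2 u u.ne_zero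
    refine ⟨h', hh', congrArg _ (Units.ext ?_)⟩
    refine Matrix.mulVec_injective (funext fun v => e.injective ?_)
    exact (hv' v).trans (hv v).symm

/-- For `g = B ∘ e`, being induced by multiplications through `e` means being conjugated by `g` to
the standard group attached to the basis `B`. -/
theorem isInducedByMultiplications_iff (B : Module.Basis (Fin n) K L)
    {g : Matrix.GeneralLinearGroup (Fin n) K} {e : (Fin n → K) ≃ₗ[K] L}
    (hge : ∀ v, g • v = B.equivFun (e v)) (G : Subgroup (Matrix.ProjGenLinGroup (Fin n) K)) :
    IsInducedByMultiplications e G ↔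
      G.map (MulAut.conj (.mk g : Matrix.ProjGenLinGroup (Fin n) K)).toMonoidHom =
        fieldSingerCycle B := by
  set M : Lˣ →* Matrix.GeneralLinearGroup (Fin n) K :=
    Units.map ((Algebra.leftMulMatrix B : L →ₐ[K] Matrix (Fin n) (Fin n) K) :
      L →* Matrix (Fin n) (Fin n) K) with hM
  have hMv : ∀ (u : Lˣ) v, M u • (g • v) = B.equivFun (u * e v) := by
    intro u v
    rw [hge]
    exact Algebra.leftMulMatrix_mulVec_repr B u (e v)
  have key : ∀ (u : Lˣ) (h : Matrix.GeneralLinearGroup (Fin n) K),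
      (∀ v, e (h • v) = u * e v) ↔ h = g⁻¹ * M u * g := by
    intro u h
    have h1 : ∀ v, e (h • v) = u * e v ↔ h • v = (g⁻¹ * M u * g) • v := by
      intro v
      rw [mul_smul, mul_smul, eq_inv_smul_iff, hMv, hge, B.equivFun.injective.eq_iff]
    rw [forall_congr' h1]
    refine ⟨fun h2 => Units.ext (Matrix.mulVec_injective (funext h2)), fun h2 v => by rw [h2]⟩
  have hmem : ∀ φ, (∃ (u : Lˣ) (h : Matrix.GeneralLinearGroup (Fin n) K),
      .mk h = φ ∧ ∀ v, e (h • v) = u * e v) ↔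
      MulAut.conj (.mk g : Matrix.ProjGenLinGroup (Fin n) K) φ ∈ fieldSingerCycle B := by
    intro φ
    have h2 : ∀ ψ, ψ ∈ fieldSingerCycle B ↔ ∃ u, .mk (M u) = ψ := fun ψ => Iff.rfl
    rw [h2]
    refine exists_congr fun u => ?_
    rw [MulAut.conj_apply, eq_mul_inv_iff_mul_eq, ← inv_mul_eq_iff_eq_mul]
    constructor
    · rintro ⟨h, rfl, hv⟩
      rw [(key u h).mp hv, map_mul, map_mul, map_inv, mul_assoc]
    · intro h3
      refine ⟨g⁻¹ * M u * g, ?_, (key u _).mpr rfl⟩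
      rw [← h3, map_mul, map_mul, map_inv, mul_assoc]
  constructor
  · intro h
    ext ψ
    rw [Subgroup.mem_map_equiv, h, hmem, MulEquiv.apply_symm_apply]
  · intro h φ
    rw [hmem, ← h, Subgroup.mem_map_equiv, MulEquiv.symm_apply_apply]

theorem projDim_inf_image {e : (Fin n → K) ≃ₗ[K] L}
    {Λ : Projectivization.Subspace K (Fin n → K)} {S : Submodule K L}
    (hS : ∀ v, v ∈ Λ.submodule ↔ e v ∈ S) {h : Matrix.GeneralLinearGroup (Fin n) K} {u : Lˣ}
    (hh : ∀ v, e (h • v) = u * e v) :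
    projDim (Λ ⊓ image (.mk h) Λ) = (Module.finrank K (slice S (u⁻¹ : Lˣ)) : ℤ) - 1 := by
  have hinf : (Λ ⊓ image (.mk h) Λ).submodule = Λ.submodule ⊓ (image (.mk h) Λ).submodule := by
    ext v
    rcases eq_or_ne v 0 with rfl | hv
    · exact iff_of_true (zero_mem _) (zero_mem _)
    · rw [Submodule.mem_inf, Projectivization.Subspace.mem_submodule_iff _ hv,
        Projectivization.Subspace.mem_submodule_iff _ hv,
        Projectivization.Subspace.mem_submodule_iff _ hv]
      rfl
  have hmap : ((Λ ⊓ image (.mk h) Λ).submodule).map (e : (Fin n → K) →ₗ[K] L) =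
      slice S (u⁻¹ : Lˣ) := by
    ext y
    obtain ⟨v, rfl⟩ := e.surjective y
    have hinv : e (h⁻¹ • v) = (u⁻¹ : Lˣ) * e v := by
      rw [Units.eq_inv_mul_iff_mul_eq, ← hh, smul_inv_smul]
    rw [Submodule.mem_map_equiv, LinearEquiv.symm_apply_apply, hinf,
      Submodule.mem_inf, mem_submodule_image, hS, hS, hinv, mem_slice]
  rw [projDim, ← hmap, LinearEquiv.finrank_map_eq]

theorem orbitIntersections_nonempty_iff {e : (Fin n → K) ≃ₗ[K] L}
    {G : Subgroup (Matrix.ProjGenLinGroup (Fin n) K)} (hG : IsInducedByMultiplications e G)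
    {Λ : Projectivization.Subspace K (Fin n → K)} {S : Submodule K L}
    (hS : ∀ v, v ∈ Λ.submodule ↔ e v ∈ S) :
    (∀ d : ℕ, d < Module.finrank K S →
      (orbitIntersections G Λ ∩ projGrassmannian K n ((d : ℤ) - 1)).Nonempty) ↔
    FullSpectrum S := by
  refine forall₂_congr fun d hd => ?_
  constructor
  · rintro ⟨_, ⟨φ, hφ, rfl⟩, hdim⟩
    obtain ⟨u, h, rfl, hv⟩ := (hG φ).mp hφ
    refine ⟨(u⁻¹ : Lˣ), ?_⟩
    have h1 : projDim (Λ ⊓ image (.mk h) Λ) = (d : ℤ) - 1 := hdim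
    rw [projDim_inf_image hS hv] at h1
    omega
  · rintro ⟨γ, hγ⟩
    have hγ0 : γ ≠ 0 := by
      rintro rfl
      have : slice S (0 : L) = S := le_antisymm (slice_le _ _) fun x hx => ⟨hx, by simp⟩
      rw [this] at hγ
      omega
    let u : Lˣ := (Units.mk0 γ hγ0)⁻¹
    let f : (Fin n → K) ≃ₗ[K] (Fin n → K) :=
      e.trans ((LinearEquiv.smulOfUnit u).restrictScalars K |>.trans e.symm)
    let h : Matrix.GeneralLinearGroup (Fin n) K :=
      Matrix.GeneralLinearGroup.toLin.symm (LinearMap.GeneralLinearGroup.ofLinearEquiv f)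
    have hh : ∀ v, e (h • v) = u * e v := by
      intro v
      have h1 : h • v = f v := by
        change Matrix.mulVec (LinearMap.toMatrix' (f : (Fin n → K) →ₗ[K] (Fin n → K))) v = f v
        rw [LinearMap.toMatrix'_mulVec]
        rfl
      rw [h1]
      exact e.apply_symm_apply _
    refine ⟨Λ ⊓ image (.mk h) Λ, ⟨_, (hG _).mpr ⟨u, h, rfl, hh⟩, rfl⟩, ?_⟩
    change projDim _ = _
    rw [projDim_inf_image hS hh, inv_inv, Units.val_mk0, hγ]

end Transport

end SingerOrbit

theorem theorem7p1 {K L : Type*} [Field K] [Finite K] [Field L] [Algebra K L] {n k : ℕ}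
    (B : Module.Basis (Fin n) K L)
    (G : Subgroup (Matrix.ProjGenLinGroup (Fin n) K)) (hG : SingerOrbit.IsSingerCycle G)
    (Λ : Projectivization.Subspace K (Fin n → K))
    (hΛ : Λ ∈ SingerOrbit.projGrassmannian K n ((k : ℤ) - 1))
    (hnk : ¬ (n = 1 ∧ k = 0)) :
    (∀ d : ℕ, d < k →
      (SingerOrbit.orbitIntersections G Λ ∩
        SingerOrbit.projGrassmannian K n ((d : ℤ) - 1)).Nonempty) ↔
    ∃ (g : Matrix.ProjGenLinGroup (Fin n) K) (S : Submodule K L),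
      G.map (MulAut.conj g).toMonoidHom = SingerOrbit.fieldSingerCycle B ∧
      SingerOrbit.image g Λ = SingerOrbit.definedBy B S ∧
      (SingerOrbit.IsFamilyOne k S ∨ SingerOrbit.IsFamilyTwo k S) := by
  open SingerOrbit in
  have : FiniteDimensional K L := B.finiteDimensional_of_finite
  have hn : Module.finrank K L = n := by rw [Module.finrank_eq_card_basis B, Fintype.card_fin]
  have hk : Module.finrank K Λ.submodule = k := by
    have h1 : (Module.finrank K Λ.submodule : ℤ) - 1 = k - 1 := hΛ
    omega
  -- a linear equivalence carrying `Λ` to `S` preserves the dimension `k`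
  have hdim : ∀ (e : (Fin n → K) ≃ₗ[K] L) (S : Submodule K L),
      (∀ v, v ∈ Λ.submodule ↔ e v ∈ S) → Module.finrank K S = k := by
    intro e S hS
    have hmap : Λ.submodule.map (e : (Fin n → K) →ₗ[K] L) = S := by
      ext y
      rw [Submodule.mem_map_equiv, hS, LinearEquiv.apply_symm_apply]
    rw [← hmap, LinearEquiv.finrank_map_eq, hk]
  constructor
  · intro h
    obtain ⟨e, he⟩ := hG.exists_isInducedByMultiplications hn
    set S := Λ.submodule.map (e : (Fin n → K) →ₗ[K] L) with hS
    have hSmem : ∀ v, v ∈ Λ.submodule ↔ e v ∈ S := fun v => by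
      rw [hS, Submodule.mem_map_equiv, LinearEquiv.symm_apply_apply]
    have hSk := hdim e S hSmem
    subst hSk
    obtain ⟨c, hc, T, hT, hfam⟩ := exists_family_of_fullSpectrum
      ((orbitIntersections_nonempty_iff he hSmem).mp h) (by rwa [hn])
    let e' : (Fin n → K) ≃ₗ[K] L :=
      e.trans ((LinearEquiv.smulOfUnit (Units.mk0 c hc)⁻¹).restrictScalars K)
    have he' : ∀ v, e v = c * e' v := fun v => (mul_inv_cancel_left₀ hc (e v)).symm
    let f := e'.trans B.equivFun
    let g : Matrix.GeneralLinearGroup (Fin n) K :=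
      Matrix.GeneralLinearGroup.toLin.symm (LinearMap.GeneralLinearGroup.ofLinearEquiv f)
    have hge : ∀ v, g • v = B.equivFun (e' v) := fun v => by
      change Matrix.mulVec (LinearMap.toMatrix' (f : (Fin n → K) →ₗ[K] (Fin n → K))) v = f v
      rw [LinearMap.toMatrix'_mulVec]
      rfl
    refine ⟨.mk g, T, (isInducedByMultiplications_iff B hge G).mp (he.smul hc he'),
      (image_eq_definedBy_iff B hge Λ T).mpr fun v => ?_, hfam⟩
    rw [hSmem, ← hT, he', Submodule.mem_map]
    constructor
    · rintro ⟨y, hy, hyv⟩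
      rwa [← mul_left_cancel₀ hc hyv]
    · exact fun hv => ⟨_, hv, rfl⟩
  · rintro ⟨g, S, hgG, hgS, hfam⟩
    induction g using Matrix.ProjGenLinGroup.induction_on with
    | mk g =>
      let e : (Fin n → K) ≃ₗ[K] L :=
        (Matrix.GeneralLinearGroup.toLin g).toLinearEquiv.trans B.equivFun.symm
      have hge : ∀ v, g • v = B.equivFun (e v) := fun v => by
        change g • v = B.equivFun (B.equivFun.symm _)
        rw [LinearEquiv.apply_symm_apply]
        rfl
      have hSmem := (image_eq_definedBy_iff B hge Λ S).mp hgS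
      rw [← hdim e S hSmem]
      refine (orbitIntersections_nonempty_iff
        ((isInducedByMultiplications_iff B hge G).mpr hgG) hSmem).mpr ?_
      exact hfam.elim IsFamilyOne.fullSpectrum IsFamilyTwo.fullSpectrum
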